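/- Let $\mathbb D$ be the open unit disk, $dA$ area measure, $|E|$ the area of $E\subset\mathbb D$. For an arc $I\subset\mathbb T$ with centre $e^{i\theta}$ and arc length $|I|\in(0,2\pi]$, and for $0<\rho<1$, let $$Q_I=\{re^{i\alpha}\in\mathbb D: 1-|I|<r<1,\ |\theta-\alpha|<|I|/2\},\qquad T_{I,\rho}=\{re^{i\alpha}\in\mathbb D: 1-|I|<r<1-(1-\rho)|I|,\ |\theta-\alpha|<|I|/2\}$$ (with $r\ge 0$) be the Carleson box of $I$ and its $\rho$-top. A weight is a strictly positive, integrable function $w$ on $\mathbb D$; write $w(E)=\int_E w\,dA$, and let $Mf(z)=\sup_{Q_J\ni z}\frac1{|Q_J|}\int_{Q_J}|f|\,dA$ be the maximal function over Carleson boxes. **Theorem.** Let $w$ be a weight for which there are $0<\rho<1$ and a constant $C_\rho$ such that for every arc $I$ $$C_\rho^{-1}w(\xi)\le w(z)\le C_\rho w(\xi)\qquad\text{for all } z,\xi\in T_{I,\rho}.$$ Then the following are equivalent: (1) $w\in B_\infty$, that is, $B_\infty(w):=\sup_I \frac1{w(Q_I)}\int_{Q_I}M(w1_{Q_I})\,dA<\infty$;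 (2) there is $C>0$ such that $\int_{Q_I}w\log\left(e+\frac{w\,|Q_I|}{w(Q_I)}\right)dA\le C\,w(Q_I)$ for every arc $I$; (3) for each $0<\varepsilon<1$ there is $\delta>0$ such that for every arc $I$ and every countable family of disjoint arcs $I_i\subset I$, with $Q_E=\bigcup_iQ_{I_i}$: if $|Q_E|/|Q_I|<\delta$, then $w(Q_E)<\varepsilon\,w(Q_I)$; (3′) for each $0<\varepsilon<1$ there is $\delta>0$ such that for every arc $I$ and every measurable $\Omega\subset Q_I$: if $|\Omega|/|Q_I|<\delta$, then $w(\Omega)<\varepsilon\,w(Q_I)$; (4) there are $r>1$ and $C>0$ such that $\left(\frac1{|Q_I|}\int_{Q_I}w^r\,dA\right)^{1/r}\le \frac{C}{|Q_I|}\int_{Q_I}w\,dA$ for every arc $I$; (5) there is $p>1$ such that, with $p'=p/(p-1)$, $B_p(w):=\sup_I\left(\frac1{|Q_I|}\int_{Q_I}w\,dA\right)\left(\frac1{|Q_I|}\int_{Q_I}w^{1-p'}dA\right)^{p-1}<\infty$; (6) $\log (w^{-1})$ is integrable on every $Q_I$, and there is $C>0$ such that $\left(\frac1{|Q_I|}\int_{Q_I}w\,dA\right)\exp\left(\frac1{|Q_I|}\int_{Q_I}\log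 (w^{-1})\,dA\right)\le C$ for every arc $I$. Moreover, if $w\in B_\infty$, then in (2) one can choose $C=C'B_\infty(w)$, where $C'$ depends only on the constants $\rho$ and $C_\rho$ of the near-constancy condition. -/

import Mathlib

open MeasureTheory
open scoped ENNReal

noncomputable section

namespace Bekolle

/-- An interval (arc) of the unit circle, given by its centre `e^{iθ}`, where `θ = center`,
and its arc length `length ∈ (0, 2π]`. -/
structure Arc where
  center : ℝ
  length : ℝ
  length_pos : 0 < length
  length_le : length ≤ 2 * Real.pi

/-- The (open) arc as a subset of the unit circle. -/
def Arc.toSet (I : Arc) : Set Circle :=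
  {ζ | ∃ α : ℝ, |I.center - α| < I.length / 2 ∧ ζ = Circle.exp α}

/-- The Carleson box `Q_I = {r e^{iα} : 1 - |I| < r < 1, |θ - α| < |I| / 2}`, in polar
coordinates, so that `r` is the modulus. -/
def Arc.box (I : Arc) : Set ℂ :=
  {z | ∃ r α : ℝ, 0 ≤ r ∧ 1 - I.length < r ∧ r < 1 ∧ |I.center - α| < I.length / 2 ∧
    z = r * Complex.exp (α * Complex.I)}

/-- The `ρ`-top `T_{I,ρ}` of the Carleson box `Q_I`. -/
def Arc.top (I : Arc) (ρ : ℝ) : Set ℂ :=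
  {z | ∃ r α : ℝ, 0 ≤ r ∧ 1 - I.length < r ∧ r < 1 - (1 - ρ) * I.length ∧
    |I.center - α| < I.length / 2 ∧ z = r * Complex.exp (α * Complex.I)}

/-- A weight on the unit disk: strictly positive and (Lebesgue measurable and) integrable with
respect to area.  The values of `w` outside the disk play no role. -/
def IsWeight (w : ℂ → ℝ) : Prop :=
  (∀ z ∈ Metric.ball (0 : ℂ) 1, 0 < w z) ∧ IntegrableOn w (Metric.ball (0 : ℂ) 1) volume

/-- `w` is constant up to the factor `K` on the `ρ`-top of every Carleson box. -/
def NearlyConstantOnTops (ρ K : ℝ) (w : ℂ → ℝ) : Prop :=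
  ∀ I : Arc, ∀ z ∈ I.top ρ, ∀ ξ ∈ I.top ρ, K⁻¹ * w ξ ≤ w z ∧ w z ≤ K * w ξ

/-- `w(E) = ∫_E w dA`. -/
def mass (w : ℂ → ℝ) (E : Set ℂ) : ℝ≥0∞ := ∫⁻ z in E, ENNReal.ofReal (w z)

/-- The Hardy–Littlewood maximal function over Carleson boxes, for nonnegative `f`. -/
def maximal (f : ℂ → ℝ≥0∞) (z : ℂ) : ℝ≥0∞ :=
  ⨆ (J : Arc) (_ : z ∈ J.box), ⨍⁻ ξ in J.box, f ξ ∂volume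

/-- The Fujii–Wilson constant `B_∞(w)`. -/
def BInfty (w : ℂ → ℝ) : ℝ≥0∞ :=
  ⨆ I : Arc, (∫⁻ z in I.box, maximal (I.box.indicator fun ξ => ENNReal.ofReal (w ξ)) z) /
    mass w I.box

/-- The Békollé–Bonami constant `B_p(w)`; here `p' = p / (p - 1)`. -/
def Bp (p : ℝ) (w : ℂ → ℝ) : ℝ≥0∞ :=
  ⨆ I : Arc, (⨍⁻ z in I.box, ENNReal.ofReal (w z) ∂volume) *
    (⨍⁻ z in I.box, ENNReal.ofReal (w z ^ (1 - p / (p - 1))) ∂volume) ^ (p - 1)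

/-- The `L log L` bound with constant `C` on all Carleson boxes. -/
def LLogLBound (w : ℂ → ℝ) (C : ℝ) : Prop :=
  ∀ I : Arc,
    ∫⁻ z in I.box, ENNReal.ofReal
        (w z * Real.log (Real.exp 1 + w z * (volume I.box).toReal / (mass w I.box).toReal))
      ≤ ENNReal.ofReal C * mass w I.box

/-- `w(Q_E)` is small relative to `w(Q_I)` whenever `Q_E` is small relative to `Q_I`, where
`E ⊆ I` is a countable union of disjoint intervals and `Q_E` the union of their boxes. -/
def SmallOnIntervalUnions (w : ℂ → ℝ) : Prop :=
  ∀ ε : ℝ, 0 < ε → ε < 1 → ∃ δ : ℝ, 0 < δ ∧ ∀ I : Arc, ∀ E : Set Arc,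
    E.Countable → E.PairwiseDisjoint Arc.toSet → (∀ J ∈ E, J.toSet ⊆ I.toSet) →
    volume (⋃ J ∈ E, J.box) / volume I.box < ENNReal.ofReal δ →
    mass w (⋃ J ∈ E, J.box) < ENNReal.ofReal ε * mass w I.box

/-- `w(Ω)` is small relative to `w(Q_I)` whenever `Ω ⊆ Q_I` is Lebesgue measurable and small
relative to `Q_I`. -/
def SmallOnSubsets (w : ℂ → ℝ) : Prop :=
  ∀ ε : ℝ, 0 < ε → ε < 1 → ∃ δ : ℝ, 0 < δ ∧ ∀ I : Arc, ∀ Ω : Set ℂ,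
    NullMeasurableSet Ω volume → Ω ⊆ I.box →
    volume Ω / volume I.box < ENNReal.ofReal δ →
    mass w Ω < ENNReal.ofReal ε * mass w I.box

/-- The reverse Hölder property on Carleson boxes. -/
def ReverseHolder (w : ℂ → ℝ) : Prop :=
  ∃ r C : ℝ, 1 < r ∧ 0 < C ∧ ∀ I : Arc,
    (⨍⁻ z in I.box, ENNReal.ofReal (w z ^ r) ∂volume) ^ (1 / r) ≤
      ENNReal.ofReal C * ⨍⁻ z in I.box, ENNReal.ofReal (w z) ∂volume

/-- The exponential condition; the integrability of `log w⁻¹` on every box is part of it. -/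
def ExpCondition (w : ℂ → ℝ) : Prop :=
  ∃ C : ℝ, 0 < C ∧ ∀ I : Arc,
    IntegrableOn (fun z => Real.log (w z)⁻¹) I.box volume ∧
    (⨍ z in I.box, w z) * Real.exp (⨍ z in I.box, Real.log (w z)⁻¹) ≤ C

end Bekolle

end

/-! The Carleson boxes of the dyadic subarcs of an arc form a binary tree, and almost every point of
a box lies in the top half of some box of the tree. Near constancy on tops bounds `w` there by a
multiple of its average over that box. Box averages therefore control the values of `w`, a
substitute for Lebesgue differentiation. The two pointwise inputs are `Arc.ae_exists_sub` and
`ofReal_mul_volume_le_mass`.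

The rest is a Calderón–Zygmund stopping argument for two measures on a tree. If unions of tree nodes
with small `μ`-measure carry at most a fraction `ε < 1` of `ν`, then the sets where the density of
`ν` exceeds `L ^ k * a` decay like `ε ^ k`, so a small power of the density is `ν`-integrable
(`lintegral_rpow_le`). With `μ` the area and `ν = w dA` this gives reverse Hölder. With the roles
exchanged it integrates a negative power of `w` and gives `B_p`; then the tree needs `w dA` to be
doubling and `1 / w` to be bounded by reciprocal averages, both of which follow because smallness
keeps half of the mass of a box away from the circle.

The Fujii–Wilson and `L log L` conditions are equivalent by layer-cake sums over dyadic levels: one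
direction uses the weak type bound for the maximal function, the other the stopping sets. `L log L`
yields smallness on subsets, hence on unions of boxes, hence reverse Hölder, which returns to `L log
L`. Smallness on subsets also yields `B_p`, which gives the exponential condition by Jensen. The
exponential condition gives smallness for a single pair of constants, and that is all the stopping
argument needs. -/

namespace Bekolle
open Set

/-! ### Geometry and area of Carleson boxes -/

/-- The open annular sector `{a < |z| < b, |arg z - θ| < ℓ / 2}`. -/
def sector (θ ℓ a b : ℝ) : Set ℂ :=
  {z | a < ‖z‖ ∧ ‖z‖ < b ∧ |(z * Complex.exp (-(θ * Complex.I))).arg| < ℓ / 2}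

/-- Since `ℓ / 2 ≤ π`, an angle within `ℓ / 2` of `θ` is read off by the principal argument after
rotating by `-θ`. The argument form is visibly measurable; the polar form matches the definition of
a box. -/
theorem mem_sector_iff {θ ℓ a b : ℝ} (h0 : 0 < ℓ) (hl : ℓ ≤ 2 * Real.pi) (z : ℂ) :
    z ∈ sector θ ℓ a b ↔ ∃ r α : ℝ, 0 ≤ r ∧ a < r ∧ r < b ∧ |θ - α| < ℓ / 2 ∧
      z = r * Complex.exp (α * Complex.I) := by
  constructor
  · rintro ⟨h1, h2, h3⟩
    set u := z * Complex.exp (-(θ * Complex.I)) with hu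
    refine ⟨‖z‖, θ + u.arg, norm_nonneg _, h1, h2, ?_, ?_⟩
    · rwa [show θ - (θ + u.arg) = -u.arg by ring, abs_neg]
    · have hn : ‖u‖ = ‖z‖ := by
        rw [hu, norm_mul, show -(θ * Complex.I) = ((-θ : ℝ) : ℂ) * Complex.I by push_cast; ring,
          Complex.norm_exp_ofReal_mul_I, mul_one]
      have hp := Complex.norm_mul_exp_arg_mul_I u
      rw [hn] at hp
      push_cast
      rw [add_mul, Complex.exp_add, mul_left_comm, hp, hu, mul_left_comm, ← Complex.exp_add]
      simp
  · rintro ⟨r, α, hr, h1, h2, h3, rfl⟩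
    have hn : ‖(r : ℂ) * Complex.exp (α * Complex.I)‖ = r := by
      rw [norm_mul, Complex.norm_exp_ofReal_mul_I, mul_one, Complex.norm_real, Real.norm_eq_abs,
        abs_of_nonneg hr]
    refine ⟨by rwa [hn], by rwa [hn], ?_⟩
    have he : (r : ℂ) * Complex.exp (α * Complex.I) * Complex.exp (-(θ * Complex.I)) =
        r * Complex.exp ((α - θ : ℝ) * Complex.I) := by
      rw [mul_assoc, ← Complex.exp_add]
      push_cast
      ring_nf
    rw [he]
    rcases hr.eq_or_lt with rfl | hr
    · simpa using h0
    · rw [abs_lt] at h3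
      rw [Complex.exp_mul_I, Complex.arg_mul_cos_add_sin_mul_I hr ⟨by linarith, by linarith⟩, abs_lt]
      constructor <;> linarith

theorem Arc.box_eq_sector (I : Arc) : I.box = sector I.center I.length (1 - I.length) 1 := by
  ext z
  rw [mem_sector_iff I.length_pos I.length_le]
  rfl

theorem measurableSet_sector (θ ℓ a b : ℝ) : MeasurableSet (sector θ ℓ a b) := by
  have h1 : Measurable fun z : ℂ => ‖z‖ := measurable_norm
  have h2 : Measurable fun z : ℂ => |(z * Complex.exp (-(θ * Complex.I))).arg| :=
    (Complex.measurable_arg.comp (measurable_id.mul_const _)).norm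
  exact (measurableSet_lt measurable_const h1).inter
    ((measurableSet_lt h1 measurable_const).inter (measurableSet_lt h2 measurable_const))

theorem Arc.measurableSet_box (I : Arc) : MeasurableSet I.box := by
  rw [I.box_eq_sector]; exact measurableSet_sector _ _ _ _

theorem volume_sector {θ ℓ a b : ℝ} (hl : ℓ ≤ 2 * Real.pi) (ha : 0 ≤ a)
    (hab : a ≤ b) : volume (sector θ ℓ a b) = ENNReal.ofReal (ℓ * (b ^ 2 - a ^ 2) / 2) := by
  have hrot : sector θ ℓ a b = (rotation (Circle.exp (-θ))) ⁻¹' sector 0 ℓ a b := by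
    ext z
    have e : rotation (Circle.exp (-θ)) z = z * Complex.exp (-(θ * Complex.I)) := by
      rw [rotation_apply, Circle.coe_exp, mul_comm]
      push_cast
      ring_nf
    simp only [sector, mem_ofPred_eq, mem_preimage, e, norm_mul, Complex.ofReal_zero, zero_mul,
      neg_zero, Complex.exp_zero, mul_one]
    rw [show -(θ * Complex.I) = ((-θ : ℝ) : ℂ) * Complex.I by push_cast; ring,
          Complex.norm_exp_ofReal_mul_I, mul_one]
  rw [hrot, (LinearIsometryEquiv.measurePreserving (rotation (Circle.exp (-θ)))).measure_preimage
    (measurableSet_sector _ _ _ _).nullMeasurableSet]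
  rw [← lintegral_indicator_one (measurableSet_sector _ _ _ _),
    ← Complex.lintegral_comp_polarCoord_symm]
  have hset : ∀ p ∈ polarCoord.target, ENNReal.ofReal p.1 •
      (sector 0 ℓ a b).indicator (1 : ℂ → ℝ≥0∞) (Complex.polarCoord.symm p) =
      ((Ioo a b) ×ˢ (Ioo (-(ℓ/2)) (ℓ/2))).indicator (fun p : ℝ × ℝ => ENNReal.ofReal p.1) p := by
    intro p hp
    have hp1 : 0 < p.1 := hp.1
    have hp2 : p.2 ∈ Ioo (-Real.pi) Real.pi := hp.2
    have hmem : (Complex.polarCoord.symm p) ∈ sector 0 ℓ a b ↔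
        p ∈ (Ioo a b) ×ˢ (Ioo (-(ℓ/2)) (ℓ/2)) := by
      rw [Complex.polarCoord_symm_apply]
      simp only [sector, mem_ofPred_eq, Complex.ofReal_zero, zero_mul, neg_zero, Complex.exp_zero,
        mul_one]
      push_cast
      rw [Complex.arg_mul_cos_add_sin_mul_I hp1 ⟨hp2.1, hp2.2.le⟩, norm_mul,
        ← Complex.exp_mul_I, Complex.norm_exp_ofReal_mul_I, mul_one, Complex.norm_real,
        Real.norm_eq_abs, abs_of_pos hp1, abs_lt]
      simp only [mem_prod, mem_Ioo]
      tauto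
    by_cases h : p ∈ (Ioo a b) ×ˢ (Ioo (-(ℓ/2)) (ℓ/2))
    · rw [indicator_of_mem h, indicator_of_mem (hmem.2 h)]; simp
    · rw [indicator_of_notMem h, indicator_of_notMem (fun h' => h (hmem.1 h'))]; simp
  rw [setLIntegral_congr_fun polarCoord.open_target.measurableSet hset,
    setLIntegral_indicator (measurableSet_Ioo.prod measurableSet_Ioo)]
  have hsub : ((Ioo a b) ×ˢ (Ioo (-(ℓ/2)) (ℓ/2))) ∩ polarCoord.target =
      (Ioo a b) ×ˢ (Ioo (-(ℓ/2)) (ℓ/2)) := by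
    apply inter_eq_left.2
    rintro p ⟨⟨h1, h2⟩, h3, h4⟩
    exact ⟨show (0:ℝ) < p.1 by linarith, show -Real.pi < p.2 by linarith,
      show p.2 < Real.pi by linarith⟩
  rw [hsub, Measure.volume_eq_prod, ← Measure.prod_restrict]
  have := lintegral_prod_mul (μ := volume.restrict (Ioo a b))
    (ν := volume.restrict (Ioo (-(ℓ/2)) (ℓ/2))) (f := fun r => ENNReal.ofReal r) (g := fun _ => 1)
    ENNReal.measurable_ofReal.aemeasurable aemeasurable_const
  simp only [mul_one] at this
  rw [this, setLIntegral_one, Real.volume_Ioo]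
  have hi : ∫⁻ r in Ioo a b, ENNReal.ofReal r = ENNReal.ofReal ((b ^ 2 - a ^ 2) / 2) := by
    rw [← ofReal_integral_eq_lintegral_ofReal]
    · rw [← integral_Ioc_eq_integral_Ioo, ← intervalIntegral.integral_of_le hab, integral_id]
    · exact (continuous_id.integrableOn_Icc).mono_set Ioo_subset_Icc_self
    · filter_upwards [ae_restrict_mem measurableSet_Ioo] with r hr
      exact ha.trans hr.1.le
  rw [hi, ← ENNReal.ofReal_mul (by nlinarith)]
  congr 1
  ring

/-- Once the arc is longer than 1 the radial condition is void, and the box is a full sector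
together with the origin, which is null. This is the source of the `max`. -/
theorem Arc.volume_box (I : Arc) : volume I.box =
    ENNReal.ofReal (I.length * (1 - (max 0 (1 - I.length)) ^ 2) / 2) := by
  have hp := I.length_pos
  rcases le_or_gt I.length 1 with h | h
  · rw [I.box_eq_sector, volume_sector I.length_le (by linarith) (by linarith),
      max_eq_right (by linarith)]
    norm_num
  · rw [max_eq_left (by linarith)]
    have h2 := volume_sector (θ := I.center) I.length_le le_rfl zero_le_one
    rw [← one_pow (M := ℝ) 2, ← h2, I.box_eq_sector]
    refine le_antisymm ?_ (measure_mono fun z hz => ⟨by linarith [hz.1], hz.2⟩)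
    have : sector I.center I.length (1 - I.length) 1 ⊆ {0} ∪ sector I.center I.length 0 1 := by
      intro z hz
      by_cases h0 : z = 0
      · exact Or.inl h0
      · exact Or.inr ⟨norm_pos_iff.2 h0, hz.2⟩
    refine (measure_mono this).trans ((measure_union_le _ _).trans ?_)
    simp

/-- The area of a Carleson box, as a real number. -/
noncomputable def area (ℓ : ℝ) : ℝ := ℓ * (1 - (max 0 (1 - ℓ)) ^ 2) / 2

theorem area_pos {ℓ : ℝ} (h : 0 < ℓ) : 0 < area ℓ := by
  unfold area
  rcases le_total 0 (1 - ℓ) with h' | h'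
  · rw [max_eq_right h']
    have : 0 < 1 - (1 - ℓ) ^ 2 := by nlinarith
    positivity
  · rw [max_eq_left h']; norm_num; exact h

theorem Arc.volume_box_eq (I : Arc) : volume I.box = ENNReal.ofReal (area I.length) :=
  I.volume_box

theorem Arc.volume_box_pos (I : Arc) : 0 < volume I.box := by
  rw [I.volume_box_eq]; exact ENNReal.ofReal_pos.2 (area_pos I.length_pos)

theorem Arc.volume_box_ne_top (I : Arc) : volume I.box ≠ ⊤ := by
  rw [I.volume_box_eq]; exact ENNReal.ofReal_ne_top

theorem Arc.box_subset_ball (I : Arc) : I.box ⊆ Metric.ball 0 1 := by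
  rw [I.box_eq_sector]
  intro z hz
  simpa using hz.2.1

theorem area_mul_le {ℓ c : ℝ} (h : 0 < ℓ) (hc : 1 ≤ c) : area (c * ℓ) ≤ c ^ 2 * area ℓ := by
  unfold area
  have key : 1 - max 0 (1 - c * ℓ) ^ 2 ≤ c * (1 - max 0 (1 - ℓ) ^ 2) := by
    rcases le_total 0 (1 - c * ℓ) with h1 | h1
    · rw [max_eq_right h1, max_eq_right (by nlinarith)]
      nlinarith [mul_nonneg (mul_nonneg (sub_nonneg.2 hc) (by linarith : 0 ≤ c)) (sq_nonneg ℓ)]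
    · rw [max_eq_left h1]
      rcases le_total 0 (1 - ℓ) with h2 | h2
      · rw [max_eq_right h2]; nlinarith
      · rw [max_eq_left h2]; nlinarith
  calc c * ℓ * (1 - max 0 (1 - c * ℓ) ^ 2) / 2 ≤ c * ℓ * (c * (1 - max 0 (1 - ℓ) ^ 2)) / 2 := by
        gcongr
    _ = _ := by ring

theorem circle_exp_arg {r α : ℝ} (hr : 0 < r) :
    Circle.exp (Complex.arg (r * Complex.exp (α * Complex.I))) = Circle.exp α := by
  apply Circle.ext
  rw [Circle.coe_exp, Circle.coe_exp]
  have := Complex.norm_mul_exp_arg_mul_I (r * Complex.exp (α * Complex.I))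
  rw [norm_mul, Complex.norm_exp_ofReal_mul_I, mul_one, Complex.norm_real, Real.norm_eq_abs,
        abs_of_pos hr] at this
  exact mul_left_cancel₀ (by exact_mod_cast hr.ne') this

/-- The origin has no well-defined angle and belongs to every box of length greater than 1. Away
from it, membership splits into modulus and angle, so disjoint arcs have boxes meeting at most at
the origin. -/
theorem Arc.mem_box_iff_of_ne_zero (I : Arc) {z : ℂ} (hz : z ≠ 0) :
    z ∈ I.box ↔ 1 - I.length < ‖z‖ ∧ ‖z‖ < 1 ∧ Circle.exp z.arg ∈ I.toSet := by
  constructor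
  · rintro ⟨r, α, hr, h1, h2, h3, rfl⟩
    have hr' : 0 < r := hr.lt_of_ne (by rintro rfl; simp at hz)
    rw [circle_exp_arg hr', norm_mul, Complex.norm_exp_ofReal_mul_I, mul_one, Complex.norm_real,
      Real.norm_eq_abs, abs_of_nonneg hr]
    exact ⟨h1, h2, α, h3, rfl⟩
  · rintro ⟨h1, h2, α, h3, h4⟩
    refine ⟨‖z‖, α, norm_nonneg _, h1, h2, h3, ?_⟩
    have h5 := congrArg (fun c : Circle => (c : ℂ)) h4
    simp only [Circle.coe_exp] at h5
    rw [← h5, Complex.norm_mul_exp_arg_mul_I]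

/-- Arc length is compared through the areas of the full sectors over the two arcs. -/
theorem Arc.length_le_of_toSet_subset {I J : Arc} (h : J.toSet ⊆ I.toSet) :
    J.length ≤ I.length := by
  have hs : sector J.center J.length 0 1 ⊆ sector I.center I.length 0 1 := by
    intro z hz
    have hz0 : z ≠ 0 := norm_pos_iff.1 hz.1
    rw [mem_sector_iff J.length_pos J.length_le] at hz
    obtain ⟨r, α, hr, h1, h2, h3, rfl⟩ := hz
    obtain ⟨β, hβ, he⟩ := h ⟨α, h3, rfl⟩
    rw [mem_sector_iff I.length_pos I.length_le]
    refine ⟨r, β, hr, h1, h2, hβ, ?_⟩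
    have h5 := congrArg (fun c : Circle => (c : ℂ)) he
    simp only [Circle.coe_exp] at h5
    rw [h5]
  have := measure_mono (μ := volume) hs
  rw [volume_sector J.length_le le_rfl zero_le_one,
    volume_sector I.length_le le_rfl zero_le_one,
    ENNReal.ofReal_le_ofReal_iff (by linarith [I.length_pos])] at this
  linarith

theorem Arc.box_subset_of_toSet_subset {I J : Arc} (h : J.toSet ⊆ I.toSet) : J.box ⊆ I.box := by
  have hl := Arc.length_le_of_toSet_subset h
  rintro z ⟨r, α, hr, h1, h2, h3, rfl⟩
  obtain ⟨β, hβ, he⟩ := h ⟨α, h3, rfl⟩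
  refine ⟨r, β, hr, by linarith, h2, hβ, ?_⟩
  have h5 := congrArg (fun c : Circle => (c : ℂ)) he
  simp only [Circle.coe_exp] at h5
  rw [h5]

/-! ### Dyadic subarcs and their boxes -/

/-- The left or right half of an arc. -/
noncomputable def Arc.child (I : Arc) (b : Bool) : Arc where
  center := if b then I.center + I.length / 4 else I.center - I.length / 4
  length := I.length / 2
  length_pos := by linarith [I.length_pos]
  length_le := by linarith [I.length_le, Real.pi_pos]

theorem Arc.child_toSet_subset (I : Arc) (b : Bool) : (I.child b).toSet ⊆ I.toSet := by
  rintro ζ ⟨α, h, rfl⟩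
  refine ⟨α, ?_, rfl⟩
  have := I.length_pos
  cases b <;> simp only [Arc.child] at h <;> rw [abs_lt] at * <;> norm_num at h <;>
    constructor <;> linarith

theorem Arc.child_disjoint (I : Arc) : Disjoint (I.child false).toSet (I.child true).toSet := by
  rw [Set.disjoint_left]
  rintro ζ ⟨α, h, rfl⟩ ⟨β, h', he⟩
  obtain ⟨m, hm⟩ := Circle.exp_eq_exp.1 he
  have h1 := I.length_pos
  have h2 := I.length_le
  simp only [Arc.child] at h h'
  rw [abs_lt] at h h'
  norm_num at h h'
  -- A common point would force a nonzero integer multiple of `2π` strictly between `-2π` and `0`.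
  have hm0 : (m : ℝ) * (2 * Real.pi) < 0 := by linarith
  have hm1 : -(2 * Real.pi) < (m : ℝ) * (2 * Real.pi) := by linarith
  have hpi := Real.two_pi_pos
  have a1 : (m : ℝ) < 0 := by by_contra hc; push Not at hc; nlinarith
  have a2 : (-1 : ℝ) < m := by by_contra hc; push Not at hc; nlinarith
  have : m < 0 := by exact_mod_cast a1
  have : -1 < m := by exact_mod_cast a2
  omega

/-- The dyadic subarc of `I` reached by following the list of left/right choices
(last entry first). -/
noncomputable def Arc.sub (I : Arc) : List Bool → Arc
  | [] => I
  | b :: l => (I.sub l).child b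

theorem Arc.sub_length (I : Arc) (l : List Bool) :
    (I.sub l).length = I.length / 2 ^ l.length := by
  induction l with
  | nil => simp [Arc.sub]
  | cons b l ih => simp [Arc.sub, Arc.child, ih, pow_succ]; ring

/-- The Carleson box without the origin. -/
def Arc.pbox (I : Arc) : Set ℂ := I.box \ {0}

theorem Arc.measurableSet_pbox (I : Arc) : MeasurableSet I.pbox :=
  I.measurableSet_box.diff (measurableSet_singleton 0)

theorem Arc.pbox_ae_eq (I : Arc) : I.pbox =ᵐ[volume] I.box :=
  sdiff_null_ae_eq_self (by simp)

theorem Arc.pbox_disjoint {I J : Arc} (h : Disjoint I.toSet J.toSet) : Disjoint I.pbox J.pbox := by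
  rw [Set.disjoint_left] at *
  rintro z ⟨hz, h0⟩ ⟨hz', -⟩
  exact h ((I.mem_box_iff_of_ne_zero h0).1 hz).2.2 ((J.mem_box_iff_of_ne_zero h0).1 hz').2.2

theorem Arc.pbox_child_subset (I : Arc) (b : Bool) : (I.child b).pbox ⊆ I.pbox :=
  sdiff_subset_sdiff_left (Arc.box_subset_of_toSet_subset (I.child_toSet_subset b))

theorem Arc.sub_toSet_subset (I : Arc) (l : List Bool) : (I.sub l).toSet ⊆ I.toSet := by
  induction l with
  | nil => exact subset_rfl
  | cons b l ih => exact ((I.sub l).child_toSet_subset b).trans ih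

/-- Almost every point of a box lies in the top half of the box of some dyadic subarc. -/
theorem Arc.ae_exists_sub (I : Arc) : ∀ᵐ z : ℂ ∂volume, z ∈ I.pbox →
    ∃ l, z ∈ (I.sub l).pbox ∧ (I.sub l).length / 2 ≤ 1 - ‖z‖ := by
  -- The ray over the centre of an arc is missed by both halves; all such rays lie in countably many
  -- real lines, which are null.
  have hnull : ∀ l, volume ((Submodule.span ℝ
      {Complex.exp ((I.sub l).center * Complex.I)} : Submodule ℝ ℂ) : Set ℂ) = 0 := by
    intro l
    apply Measure.addHaar_submodule
    intro htop
    have := finrank_span_singleton (K := ℝ) (v := Complex.exp ((I.sub l).center * Complex.I))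
      (Complex.exp_ne_zero _)
    rw [htop, finrank_top, Complex.finrank_real_complex] at this
    norm_num at this
  have hae : ∀ᵐ z : ℂ ∂volume, ∀ l, z ∉ (Submodule.span ℝ
      {Complex.exp ((I.sub l).center * Complex.I)} : Submodule ℝ ℂ) :=
    ae_all_iff.2 fun l => measure_eq_zero_iff_ae_notMem.1 (hnull l)
  filter_upwards [hae] with z hz hzI
  -- A point in no top half is always deep enough towards the circle to enter the box of one of the
  -- two children. It thus descends through all generations, although the box lengths tend to 0.
  by_contra hcon
  push Not at hcon
  have hind : ∀ n : ℕ, ∃ l : List Bool, l.length = n ∧ z ∈ (I.sub l).pbox := by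
    intro n
    induction n with
    | zero => exact ⟨[], rfl, hzI⟩
    | succ n ih =>
      obtain ⟨l, hl, hzl⟩ := ih
      have ht := hcon l hzl
      have hz0 : z ≠ 0 := hzl.2
      obtain ⟨r, α, hr, h1, h2, h3, he⟩ := hzl.1
      have hn : ‖z‖ = r := by
        rw [he, norm_mul, Complex.norm_exp_ofReal_mul_I, mul_one, Complex.norm_real,
          Real.norm_eq_abs, abs_of_nonneg hr]
      have hne : α ≠ (I.sub l).center := by
        rintro rfl
        apply hz l
        rw [Submodule.mem_span_singleton]
        exact ⟨r, by rw [he]; simp⟩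
      rw [abs_lt] at h3
      rcases lt_or_gt_of_ne hne with hlt | hlt
      · refine ⟨false :: l, by simp [hl], ⟨r, α, hr, ?_, h2, ?_, he⟩, hz0⟩
        · simp only [Arc.sub, Arc.child]; linarith
        · simp only [Arc.sub, Arc.child]; rw [abs_lt]; norm_num; constructor <;> linarith
      · refine ⟨true :: l, by simp [hl], ⟨r, α, hr, ?_, h2, ?_, he⟩, hz0⟩
        · simp only [Arc.sub, Arc.child]; linarith
        · simp only [Arc.sub, Arc.child]; rw [abs_lt]; norm_num; constructor <;> linarith
  have hz1 : 0 < 1 - ‖z‖ := by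
    have := I.box_subset_ball hzI.1
    simp at this; linarith
  obtain ⟨n, hn⟩ := pow_unbounded_of_one_lt (I.length / (1 - ‖z‖)) (one_lt_two : (1:ℝ) < 2)
  obtain ⟨l, hl, hzl⟩ := hind n
  have h1 := hzl.1
  rw [Arc.box_eq_sector] at h1
  have h2 := h1.1
  rw [I.sub_length, hl] at h2
  rw [div_lt_iff₀ hz1] at hn
  have : I.length / 2 ^ n < 1 - ‖z‖ := by rw [div_lt_iff₀ (by positivity)]; linarith
  linarith

theorem Arc.volume_box_le_four_mul_child (I : Arc) (b : Bool) :
    volume I.box ≤ 4 * volume (I.child b).box := by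
  rw [Arc.volume_box_eq, Arc.volume_box_eq, show (4 : ℝ≥0∞) = ENNReal.ofReal 4 by norm_num,
    ← ENNReal.ofReal_mul (by norm_num)]
  apply ENNReal.ofReal_le_ofReal
  have := area_mul_le (ℓ := I.length / 2) (by linarith [I.length_pos]) one_le_two
  rw [mul_div_cancel₀ _ two_ne_zero] at this
  calc _ ≤ _ := this
    _ = _ := by simp only [Arc.child]; norm_num

/-! ### Binary trees and first stopping nodes -/

/-- A family of sets indexed by the binary tree, in which the two children of each node are
disjoint subsets of their parent. -/
structure IsTree {α : Type*} (B : List Bool → Set α) : Prop where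
  subset : ∀ b l, B (b :: l) ⊆ B l
  disjoint : ∀ l, Disjoint (B (false :: l)) (B (true :: l))

namespace IsTree

variable {α : Type*} {B : List Bool → Set α}

/-- Lists grow at the head, so the ancestors of a node are its suffixes. -/
theorem subset_of_suffix (h : IsTree B) {l m : List Bool} (hlm : l <:+ m) : B m ⊆ B l := by
  induction m with
  | nil => rw [List.suffix_nil] at hlm; rw [hlm]
  | cons b m ih =>
    rcases List.suffix_cons_iff.1 hlm with rfl | hlm
    · exact subset_rfl
    · exact (h.subset b m).trans (ih hlm)

theorem eq_of_mem (h : IsTree B) {z : α} : ∀ {l m : List Bool}, l.length = m.length →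
    z ∈ B l → z ∈ B m → l = m
  | [], [], _, _, _ => rfl
  | [], _ :: _, hl, _, _ => by simp at hl
  | _ :: _, [], hl, _, _ => by simp at hl
  | b :: l, c :: m, hl, hz, hz' => by
    have := eq_of_mem h (by simpa using hl) (h.subset b l hz) (h.subset c m hz')
    subst this
    have hd := Set.disjoint_left.1 (h.disjoint l)
    cases b <;> cases c <;> first | rfl | exact absurd hz' (hd hz) | exact absurd hz (hd hz')

theorem suffix_of_mem (h : IsTree B) {z : α} {l m : List Bool} (hlm : l.length ≤ m.length)
    (hz : z ∈ B l) (hz' : z ∈ B m) : l <:+ m := by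
  induction m with
  | nil => rw [List.suffix_nil]; exact List.length_eq_zero_iff.1 (by simpa using hlm)
  | cons b m ih =>
    rcases hlm.eq_or_lt with he | hlt
    · rw [h.eq_of_mem he hz hz']
    · exact (ih (Nat.lt_succ_iff.1 hlt) (h.subset b m hz')).trans (List.suffix_cons b m)

/-- Two nodes sharing a point are comparable for the suffix order, which an antichain forbids. -/
theorem pairwiseDisjoint (h : IsTree B) {A : Set (List Bool)} (hA : IsAntichain (· <:+ ·) A) :
    A.PairwiseDisjoint B := by
  intro l hl m hm hne
  rw [Function.onFun, Set.disjoint_left]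
  intro z hz hz'
  rcases le_total l.length m.length with hle | hle
  · exact hA hl hm hne (h.suffix_of_mem hle hz hz')
  · exact hA hm hl hne.symm (h.suffix_of_mem hle hz' hz)

end IsTree

/-- The nodes satisfying `P` none of whose proper ancestors satisfies `P`. -/
def firstNodes (P : List Bool → Prop) : Set (List Bool) := {l | P l ∧ ∀ m, m <:+ l → P m → m = l}

theorem isAntichain_firstNodes (P : List Bool → Prop) : IsAntichain (· <:+ ·) (firstNodes P) :=
  fun _ hl _ hm hne hs => hne (hm.2 _ hs hl.1)

theorem exists_firstNode {P : List Bool → Prop} {l : List Bool} (h : P l) :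
    ∃ m ∈ firstNodes P, m <:+ l := by
  induction hn : l.length using Nat.strong_induction_on generalizing l with
  | _ n ih =>
    by_cases hex : ∃ m, m <:+ l ∧ P m ∧ m ≠ l
    · obtain ⟨m, hm, hP, hne⟩ := hex
      have hlt : m.length < n := by
        rw [← hn]
        exact lt_of_le_of_ne hm.length_le (fun e => hne (hm.eq_of_length e))
      obtain ⟨m', h1, h2⟩ := ih _ hlt hP rfl
      exact ⟨m', h1, h2.trans hm⟩
    · push Not at hex
      exact ⟨l, ⟨h, hex⟩, List.suffix_rfl⟩

/-! ### Stopping-time estimates for two measures -/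

/-- The union of the sets of all nodes at which the density of `ν` with respect to `μ`
exceeds `t`. -/
def superlevel {α : Type*} [MeasurableSpace α] (B : List Bool → Set α) (μ ν : Measure α)
    (t : ℝ≥0∞) : Set α :=
  ⋃ l ∈ firstNodes (fun l => t * μ (B l) < ν (B l)), B l

section Stopping

variable {α : Type*} [MeasurableSpace α] {B : List Bool → Set α} {μ ν : Measure α} {t u : ℝ≥0∞}

theorem mem_superlevel (hB : IsTree B) {z : α} {l : List Bool} (hz : z ∈ B l)
    (h : t * μ (B l) < ν (B l)) : z ∈ superlevel B μ ν t := by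
  obtain ⟨m, hm, hs⟩ := exists_firstNode (P := fun l => t * μ (B l) < ν (B l)) h
  exact mem_biUnion hm (hB.subset_of_suffix hs hz)

theorem measurableSet_superlevel (hm : ∀ l, MeasurableSet (B l)) :
    MeasurableSet (superlevel B μ ν t) :=
  MeasurableSet.biUnion (Set.to_countable _) fun l _ => hm l

theorem superlevel_subset (hB : IsTree B) : superlevel B μ ν t ⊆ B [] :=
  iUnion₂_subset fun _ _ => hB.subset_of_suffix List.nil_suffix

theorem measure_biUnion_le_of_forall_le (hB : IsTree B) (hm : ∀ l, MeasurableSet (B l))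
    {A : Set (List Bool)} (hA : IsAntichain (· <:+ ·) A) (c d : ℝ≥0∞)
    (h : ∀ l ∈ A, c * μ (B l) ≤ d * ν (B l)) :
    c * μ (⋃ l ∈ A, B l) ≤ d * ν (⋃ l ∈ A, B l) := by
  rw [measure_biUnion A.to_countable (hB.pairwiseDisjoint hA) fun l _ => hm l,
    measure_biUnion A.to_countable (hB.pairwiseDisjoint hA) fun l _ => hm l,
    ← ENNReal.tsum_mul_left, ← ENNReal.tsum_mul_left]
  exact ENNReal.tsum_le_tsum fun l => h l l.2

/-- The parent of a first node has not been stopped, so its density is at most `t`; doubling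
transfers this to the child. The root is excluded by `ht`. -/
theorem measure_firstNode_le (hB : IsTree B) {D : ℝ≥0∞} (hD : ∀ b l, μ (B l) ≤ D * μ (B (b :: l)))
    (ht : ν (B []) ≤ t * μ (B [])) {l : List Bool}
    (hl : l ∈ firstNodes (fun l => t * μ (B l) < ν (B l))) : ν (B l) ≤ D * t * μ (B l) := by
  cases l with
  | nil => exact absurd hl.1 (not_lt.2 ht)
  | cons b l =>
    have : ¬ (t * μ (B l) < ν (B l)) := fun h => by
      have := hl.2 l (List.suffix_cons b l) h
      simp at this
    calc ν (B (b :: l)) ≤ ν (B l) := measure_mono (hB.subset b l)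
      _ ≤ t * μ (B l) := not_lt.1 this
      _ ≤ t * (D * μ (B (b :: l))) := by gcongr; exact hD b l
      _ = _ := by ring

theorem measure_superlevel_le (hB : IsTree B) (hm : ∀ l, MeasurableSet (B l)) {D : ℝ≥0∞}
    (hD : ∀ b l, μ (B l) ≤ D * μ (B (b :: l))) (ht : ν (B []) ≤ t * μ (B [])) :
    ν (superlevel B μ ν t) ≤ D * t * μ (superlevel B μ ν t) := by
  have := measure_biUnion_le_of_forall_le (μ := ν) (ν := μ) hB hm
    (isAntichain_firstNodes fun l => t * μ (B l) < ν (B l)) 1 (D * t)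
    fun l hl => by rw [one_mul]; exact measure_firstNode_le hB hD ht hl
  rwa [one_mul] at this

/-- Smallness of `ν` on sets of small `μ`-measure makes the superlevel sets decay. -/
theorem measure_superlevel_mul_le (hB : IsTree B) (hm : ∀ l, MeasurableSet (B l))
    {D δ ε L : ℝ≥0∞}
    (hD : ∀ b l, μ (B l) ≤ D * μ (B (b :: l)))
    (hsmall : ∀ (l : List Bool) (A : Set (List Bool)), IsAntichain (· <:+ ·) A →
      (∀ m ∈ A, l <:+ m) → μ (⋃ m ∈ A, B m) ≤ δ * μ (B l) →
      ν (⋃ m ∈ A, B m) ≤ ε * ν (B l))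
    (hL : D ≤ δ * L) (hL1 : 1 ≤ L) (hLt : L ≠ ⊤) (ht0 : t ≠ 0) (htt : t ≠ ⊤)
    (ht : ν (B []) ≤ t * μ (B [])) :
    ν (superlevel B μ ν (L * t)) ≤ ε * ν (superlevel B μ ν t) := by
  set S := firstNodes (fun l => t * μ (B l) < ν (B l)) with hS
  set S' := firstNodes (fun l => L * t * μ (B l) < ν (B l)) with hS'
  have hcover : superlevel B μ ν (L * t) ⊆ ⋃ l ∈ S, ⋃ m ∈ {m | m ∈ S' ∧ l <:+ m}, B m := by
    refine iUnion₂_subset fun m hm' z hz => ?_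
    have : t * μ (B m) < ν (B m) := by
      refine lt_of_le_of_lt ?_ hm'.1
      gcongr
      exact le_mul_of_one_le_left zero_le hL1
    obtain ⟨l, hl, hlm⟩ := exists_firstNode (P := fun l => t * μ (B l) < ν (B l)) this
    exact mem_biUnion hl (mem_biUnion (show m ∈ {m | m ∈ S' ∧ l <:+ m} from ⟨hm', hlm⟩) hz)
  -- Inside a node stopped at level `t`, the `ν`-mass is at most `D * t * μ`, while nodes stopped at
  -- level `L * t` have density above `L * t`. Their `μ`-measure is thus at most the fraction `D / L
  -- ≤ δ`, and smallness applies.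
  have hpiece : ∀ l ∈ S, ν (⋃ m ∈ {m | m ∈ S' ∧ l <:+ m}, B m) ≤ ε * ν (B l) := by
    intro l hl
    have hA : IsAntichain (· <:+ ·) {m | m ∈ S' ∧ l <:+ m} :=
      (isAntichain_firstNodes _).subset fun m hm' => hm'.1
    refine hsmall l _ hA (fun m hm' => hm'.2) ?_
    have h1 := measure_biUnion_le_of_forall_le (μ := μ) (ν := ν) hB hm hA (L * t) 1
      fun m hm' => by rw [one_mul]; exact hm'.1.1.le
    rw [one_mul] at h1
    have h2 : ν (⋃ m ∈ {m | m ∈ S' ∧ l <:+ m}, B m) ≤ ν (B l) :=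
      measure_mono (iUnion₂_subset fun m hm' => hB.subset_of_suffix hm'.2)
    have h3 : L * t * μ (⋃ m ∈ {m | m ∈ S' ∧ l <:+ m}, B m) ≤ L * t * (δ * μ (B l)) :=
      calc _ ≤ _ := h1.trans (h2.trans (measure_firstNode_le hB hD ht hl))
        _ ≤ (δ * L) * t * μ (B l) := by gcongr
        _ = _ := by ring
    refine (ENNReal.mul_le_mul_iff_right ?_ ?_).1 h3
    · exact mul_ne_zero (by rintro rfl; simp at hL1) ht0
    · exact ENNReal.mul_ne_top hLt htt
  calc ν (superlevel B μ ν (L * t)) ≤ ν (⋃ l ∈ S, ⋃ m ∈ {m | m ∈ S' ∧ l <:+ m}, B m) :=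
        measure_mono hcover
    _ ≤ ∑' l : S, ν (⋃ m ∈ {m | m ∈ S' ∧ (l : List Bool) <:+ m}, B m) :=
        measure_biUnion_le _ S.to_countable _
    _ ≤ ∑' l : S, ε * ν (B l) := ENNReal.tsum_le_tsum fun l => hpiece l l.2
    _ = ε * ν (superlevel B μ ν t) := by
        rw [ENNReal.tsum_mul_left, superlevel, measure_biUnion S.to_countable
          (hB.pairwiseDisjoint (isAntichain_firstNodes _)) fun l _ => hm l]

/-- Outside the superlevel set every node containing `z` has density at most `t`, in particular the
one whose density controls `x`. -/
theorem le_mul_of_notMem_superlevel (hB : IsTree B) (hμ0 : ∀ l, μ (B l) ≠ 0)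
    (hμ : ∀ l, μ (B l) ≠ ⊤) {C x : ℝ≥0∞} {z : α}
    (hx : ∃ l, z ∈ B l ∧ x * μ (B l) ≤ C * ν (B l)) (hz : z ∉ superlevel B μ ν t) :
    x ≤ C * t := by
  obtain ⟨l, hl, h⟩ := hx
  have h1 : ν (B l) ≤ t * μ (B l) := not_lt.1 fun h' => hz (mem_superlevel hB hl h')
  have h2 : x * μ (B l) ≤ (C * t) * μ (B l) := by
    rw [mul_assoc]; exact h.trans (by gcongr)
  exact (ENNReal.mul_le_mul_iff_left (hμ0 l) (hμ l)).1 h2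

/-- Off the next level set `E (k + 1)`, `f` is at most `C * L ^ (k + 1) * a`, and `ν (E k)` is at
most `ε ^ k` times the total; hence the geometric series. The two measures are kept abstract because
the lemma is used for area and `w dA` in both orders. -/
theorem lintegral_rpow_le (hB : IsTree B) (hm : ∀ l, MeasurableSet (B l))
    (hμ0 : ∀ l, μ (B l) ≠ 0) (hμ : ∀ l, μ (B l) ≠ ⊤) (hν : ν (B []) ≠ ⊤) {D δ ε L C a : ℝ≥0∞}
    (hD : ∀ b l, μ (B l) ≤ D * μ (B (b :: l)))
    (hsmall : ∀ (l : List Bool) (A : Set (List Bool)), IsAntichain (· <:+ ·) A →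
      (∀ m ∈ A, l <:+ m) → μ (⋃ m ∈ A, B m) ≤ δ * μ (B l) →
      ν (⋃ m ∈ A, B m) ≤ ε * ν (B l))
    (hε : ε < 1) (hL : D ≤ δ * L) (hL1 : 1 ≤ L) (hLt : L ≠ ⊤) (ha0 : a ≠ 0) (hat : a ≠ ⊤)
    (ha : ν (B []) ≤ a * μ (B []))
    {f : α → ℝ≥0∞} (hf : ∀ᵐ z ∂ν, z ∈ B [] → ∃ l, z ∈ B l ∧ f z * μ (B l) ≤ C * ν (B l))
    {s : ℝ} (hs : 0 ≤ s) :
    ∫⁻ z in B [], f z ^ s ∂ν ≤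
      (C * a) ^ s * (1 + ∑' k : ℕ, (L ^ s) ^ (k + 1) * ε ^ k) * ν (B []) := by
  have hlev : ∀ k : ℕ, a ≤ L ^ k * a := fun k => le_mul_of_one_le_left zero_le (one_le_pow₀ hL1)
  have hroot : ∀ k : ℕ, ν (B []) ≤ L ^ k * a * μ (B []) := fun k =>
    ha.trans (by gcongr; exact hlev k)
  set E : ℕ → Set α := fun k => superlevel B μ ν (L ^ k * a) with hE
  have hEm : ∀ k, MeasurableSet (E k) := fun k => measurableSet_superlevel hm
  have hL0 : L ≠ 0 := by rintro rfl; simp at hL1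
  have hdecay : ∀ k, ν (E k) ≤ ε ^ k * ν (B []) := by
    intro k
    induction k with
    | zero => simpa using measure_mono (superlevel_subset hB)
    | succ k ih =>
      have := measure_superlevel_mul_le hB hm hD hsmall hL hL1 hLt
        (mul_ne_zero (pow_ne_zero k hL0) ha0)
        (ENNReal.mul_ne_top (ENNReal.pow_ne_top hLt) hat) (hroot k)
      calc ν (E (k + 1)) = ν (superlevel B μ ν (L * (L ^ k * a))) := by
            simp only [hE]; rw [pow_succ', mul_assoc]
        _ ≤ ε * ν (E k) := this
        _ ≤ ε * (ε ^ k * ν (B [])) := by gcongr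
        _ = _ := by ring
  have hnull : ν (⋂ k, E k) = 0 := by
    have ht : Filter.Tendsto (fun k : ℕ => ε ^ k * ν (B [])) Filter.atTop (nhds 0) := by
      have := ENNReal.Tendsto.mul_const (b := ν (B []))
        (ENNReal.tendsto_pow_atTop_nhds_zero_of_lt_one hε) (Or.inr hν)
      simpa using this
    exact le_antisymm (ge_of_tendsto' ht fun k =>
      (measure_mono (iInter_subset _ k)).trans (hdecay k)) zero_le
  have hpt : ∀ᵐ z ∂(ν.restrict (B [])), f z ^ s ≤
      (C * a) ^ s * (1 + ∑' k : ℕ, (L ^ s) ^ (k + 1) * (E k).indicator 1 z) := by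
    rw [ae_restrict_iff' (hm [])]
    filter_upwards [hf, measure_eq_zero_iff_ae_notMem.1 hnull] with z hz hzE hzB
    by_cases h0 : z ∈ E 0
    · have hex : ∃ k, z ∉ E k := by simpa using hzE
      classical
      -- The first level that `z` escapes is positive since `z ∈ E 0`; write it as `k + 1`.
      obtain ⟨k, hk⟩ : ∃ k, Nat.find hex = k + 1 :=
        Nat.exists_eq_succ_of_ne_zero fun h => (h ▸ Nat.find_spec hex) h0
      have hk1 : z ∉ E (k + 1) := hk ▸ Nat.find_spec hex
      have hk2 : z ∈ E k := not_not.1 (Nat.find_min hex (by omega : k < Nat.find hex))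
      have hfz := le_mul_of_notMem_superlevel hB hμ0 hμ (hz hzB) hk1
      calc f z ^ s ≤ (C * (L ^ (k + 1) * a)) ^ s := ENNReal.rpow_le_rpow hfz hs
        _ = (C * a) ^ s * ((L ^ s) ^ (k + 1) * (E k).indicator 1 z) := by
          rw [indicator_of_mem hk2, Pi.one_apply, mul_one,
            show C * (L ^ (k + 1) * a) = (C * a) * L ^ (k + 1) by ring,
            ENNReal.mul_rpow_of_nonneg _ _ hs, ← ENNReal.rpow_natCast, ← ENNReal.rpow_natCast,
            ← ENNReal.rpow_mul, ← ENNReal.rpow_mul, mul_comm s]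
        _ ≤ _ := by
          gcongr
          exact (ENNReal.le_tsum (f := fun k => (L ^ s) ^ (k + 1) * (E k).indicator 1 z) k).trans
            le_add_self
    · have hfz := le_mul_of_notMem_superlevel hB hμ0 hμ (hz hzB) h0
      rw [pow_zero, one_mul] at hfz
      calc f z ^ s ≤ (C * a) ^ s * 1 := by rw [mul_one]; exact ENNReal.rpow_le_rpow hfz hs
        _ ≤ _ := by gcongr; exact le_self_add
  refine (lintegral_mono_ae hpt).trans ?_
  have hmeas : ∀ k : ℕ, Measurable fun z => (L ^ s) ^ (k + 1) * (E k).indicator (1 : α → ℝ≥0∞) z :=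
    fun k => (measurable_one.indicator (hEm k)).const_mul _
  rw [lintegral_const_mul _ (by fun_prop), lintegral_add_left measurable_const, lintegral_tsum
    fun k => (hmeas k).aemeasurable, lintegral_const, Measure.restrict_apply_univ, one_mul,
    mul_assoc, add_mul, one_mul, ← ENNReal.tsum_mul_right]
  gcongr with k
  rw [lintegral_const_mul _ (measurable_one.indicator (hEm k)), lintegral_indicator_one (hEm k),
    mul_assoc]
  gcongr
  exact (Measure.restrict_apply_le _ _).trans (hdecay k)

/-- A power for which the series in `lintegral_rpow_le` converges. -/
theorem exists_rpow_tsum_lt_top {ε L : ℝ≥0∞} (hε : ε < 1) (hLt : L ≠ ⊤) (hL1 : 1 ≤ L) :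
    ∃ s : ℝ, 0 < s ∧ ∑' k : ℕ, (L ^ s) ^ (k + 1) * ε ^ k < ⊤ := by
  -- The ratio of the geometric series is `L ^ s * ε`, which tends to `ε < 1` as `s` decreases to 0.
  have hLim : Filter.Tendsto (fun s : ℝ => L ^ s * ε) (nhdsWithin 0 (Ioi 0)) (nhds ε) := by
    have h1 : Filter.Tendsto (fun s : ℝ => L ^ s) (nhds 0) (nhds 1) := by
      lift L to NNReal using hLt
      have hL0 : L ≠ 0 := by rintro rfl; simp at hL1
      have hc : Continuous fun s : ℝ => ((L ^ s : NNReal) : ℝ≥0∞) :=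
        ENNReal.continuous_coe.comp <| continuous_iff_continuousAt.2 fun s =>
          (NNReal.continuousAt_rpow (x := L) (y := s) (Or.inl hL0)).comp
            (f := fun s : ℝ => (L, s)) (by fun_prop)
      have := hc.tendsto 0
      simpa [ENNReal.coe_rpow_of_ne_zero hL0] using this
    simpa using ENNReal.Tendsto.mul_const (h1.mono_left nhdsWithin_le_nhds) (Or.inl one_ne_zero)
  obtain ⟨s, hs, hs0⟩ := ((hLim.eventually (gt_mem_nhds hε)).and self_mem_nhdsWithin).exists
  refine ⟨s, hs0, ?_⟩
  have : ∀ k : ℕ, (L ^ s) ^ (k + 1) * ε ^ k = L ^ s * (L ^ s * ε) ^ k := fun k => by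
    rw [mul_pow]; ring
  simp_rw [this]
  rw [ENNReal.tsum_mul_left, ENNReal.tsum_geometric]
  exact ENNReal.mul_lt_top (ENNReal.rpow_lt_top_of_nonneg (le_of_lt hs0) hLt)
    (ENNReal.inv_lt_top.2 (tsub_pos_of_lt hs))

end Stopping

/-! ### Near constancy along chains of tops -/

theorem norm_one_sub_mul_exp {t α : ℝ} (ht : t ≤ 1) :
    ‖((1 - t : ℝ) : ℂ) * Complex.exp (α * Complex.I)‖ = 1 - t := by
  rw [norm_mul, Complex.norm_exp_ofReal_mul_I, mul_one, Complex.norm_real, Real.norm_eq_abs,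
    abs_of_nonneg (by linarith)]

theorem IsWeight.pos_polar {w : ℂ → ℝ} (hw : IsWeight w) {t α : ℝ} (h0 : 0 < t) (h1 : t ≤ 1) :
    0 < w ((1 - t : ℝ) * Complex.exp (α * Complex.I)) := by
  apply hw.1
  rw [mem_ball_zero_iff, norm_one_sub_mul_exp h1]
  linarith

namespace NearlyConstantOnTops

variable {ρ K : ℝ} {w : ℂ → ℝ}

/-- Both points lie in the top of a single arc, centred at the mean angle, with length strictly
between `t'` and `t / (1 - ρ)`. The further bound 2 only keeps the length below `2π`. -/
theorem polar_step (h : NearlyConstantOnTops ρ K w) (h0 : 0 < ρ) (h1 : ρ < 1) {t t' α α' : ℝ}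
    (ht : 0 < t) (htt' : t ≤ t') (ht' : t' ≤ 1) (hr : t' * (1 - ρ) < t) (hα : |α - α'| ≤ t) :
    w ((1 - t : ℝ) * Complex.exp (α * Complex.I)) ≤
        K * w ((1 - t' : ℝ) * Complex.exp (α' * Complex.I)) ∧
    w ((1 - t' : ℝ) * Complex.exp (α' * Complex.I)) ≤
        K * w ((1 - t : ℝ) * Complex.exp (α * Complex.I)) := by
  have h2 : t' < min (t / (1 - ρ)) 2 := lt_min (by rwa [lt_div_iff₀ (by linarith)]) (by linarith)
  obtain ⟨ℓ, hl1, hl2⟩ := exists_between h2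
  have hl3 : ℓ * (1 - ρ) < t := by
    rw [← lt_div_iff₀ (by linarith)]; exact hl2.trans_le (min_le_left _ _)
  have hl4 : ℓ < 2 := hl2.trans_le (min_le_right _ _)
  let I : Arc := ⟨(α + α') / 2, ℓ, by linarith, by linarith [Real.pi_gt_three]⟩
  rw [abs_le] at hα
  have m1 : (((1 - t : ℝ) : ℂ) * Complex.exp (α * Complex.I)) ∈ I.top ρ := by
    refine ⟨1 - t, α, by linarith, ?_, ?_, ?_, rfl⟩
    · show 1 - ℓ < _; linarith
    · show _ < 1 - (1 - ρ) * ℓ; linarith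
    · show |(α + α') / 2 - α| < ℓ / 2; rw [abs_lt]; constructor <;> linarith
  have m2 : (((1 - t' : ℝ) : ℂ) * Complex.exp (α' * Complex.I)) ∈ I.top ρ := by
    refine ⟨1 - t', α', by linarith, ?_, ?_, ?_, rfl⟩
    · show 1 - ℓ < _; linarith
    · show _ < 1 - (1 - ρ) * ℓ; linarith
    · show |(α + α') / 2 - α'| < ℓ / 2; rw [abs_lt]; constructor <;> linarith
  exact ⟨(h I _ m1 _ m2).2, (h I _ m2 _ m1).2⟩

theorem one_le (h : NearlyConstantOnTops ρ K w) (h0 : 0 < ρ) (h1 : ρ < 1) (hw : IsWeight w) :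
    1 ≤ K := by
  have hp := hw.pos_polar (α := 0) one_pos le_rfl
  have := (h.polar_step h0 h1 (α := 0) (α' := 0) one_pos le_rfl le_rfl (by linarith) (by simp)).1
  by_contra hK
  push Not at hK
  nlinarith

/-- A rotation by at most `m * t` at fixed depth `t` is cut into `m` equal steps of angle at most
`t`. -/
theorem polar_angular (h : NearlyConstantOnTops ρ K w) (h0 : 0 < ρ) (h1 : ρ < 1) (hw : IsWeight w)
    {t : ℝ} (ht : 0 < t) (ht1 : t ≤ 1) (m : ℕ) : ∀ α α' : ℝ, |α - α'| ≤ m * t →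
    w ((1 - t : ℝ) * Complex.exp (α * Complex.I)) ≤
        K ^ m * w ((1 - t : ℝ) * Complex.exp (α' * Complex.I)) := by
  have hK := h.one_le h0 h1 hw
  induction m with
  | zero =>
    intro α α' hα
    have : α = α' := by
      rw [Nat.cast_zero, zero_mul, abs_nonpos_iff] at hα
      linarith
    simp [this]
  | succ m ih =>
    intro α α' hα
    have hm : (0 : ℝ) < m + 1 := by positivity
    push_cast at hα
    have e1 : α - (α' + (α - α') * (m / (m + 1))) = (α - α') / (m + 1) := by field_simp; ring
    have s1 : |α - (α' + (α - α') * (m / (m + 1)))| ≤ t := by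
      rw [e1, abs_div, abs_of_pos hm, div_le_iff₀ hm]; linarith
    have s2 : |(α' + (α - α') * (m / (m + 1))) - α'| ≤ m * t := by
      rw [add_sub_cancel_left, abs_mul, abs_of_nonneg (a := (m / (m + 1) : ℝ)) (by positivity),
        ← mul_div_assoc, div_le_iff₀ hm]
      have : (0 : ℝ) ≤ m := Nat.cast_nonneg m
      nlinarith
    have b1 := (h.polar_step h0 h1 ht le_rfl ht1 (by nlinarith) s1).1
    have b2 := ih _ _ s2
    calc _ ≤ _ := b1
      _ ≤ K * (K ^ m * _) := by gcongr
      _ = _ := by ring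

/-- The depth grows by a factor `1 + ρ` per step, which one top can bridge because `(1 + ρ) * (1 -
ρ) < 1`. -/
theorem polar_radial (h : NearlyConstantOnTops ρ K w) (h0 : 0 < ρ) (h1 : ρ < 1) (hw : IsWeight w)
    {t : ℝ} (ht : 0 < t) (α : ℝ) (n : ℕ) : ∀ t' : ℝ, t ≤ t' → t' ≤ 1 → t' ≤ (1 + ρ) ^ n * t →
    w ((1 - t : ℝ) * Complex.exp (α * Complex.I)) ≤
        K ^ n * w ((1 - t' : ℝ) * Complex.exp (α * Complex.I)) ∧
    w ((1 - t' : ℝ) * Complex.exp (α * Complex.I)) ≤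
        K ^ n * w ((1 - t : ℝ) * Complex.exp (α * Complex.I)) := by
  have hK := h.one_le h0 h1 hw
  induction n with
  | zero =>
    intro t' h2 _ h4
    have : t' = t := by linarith
    simp [this]
  | succ n ih =>
    intro t' h2 h3 h4
    by_cases hc : t' ≤ (1 + ρ) ^ n * t
    · obtain ⟨i1, i2⟩ := ih t' h2 h3 hc
      have hp := hw.pos_polar (α := α) ht (h2.trans h3)
      have hp' := hw.pos_polar (α := α) (ht.trans_le h2) h3
      have hle : K ^ n ≤ K ^ (n + 1) := pow_le_pow_right₀ hK (Nat.le_succ n)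
      exact ⟨i1.trans (by gcongr), i2.trans (by gcongr)⟩
    · push Not at hc
      have hρ : (0 : ℝ) < 1 + ρ := by linarith
      have hpow : (1 : ℝ) ≤ (1 + ρ) ^ n := one_le_pow₀ (by linarith)
      have ht1 : t ≤ (1 + ρ) ^ n * t := le_mul_of_one_le_left ht.le hpow
      have hs0 : 0 < (1 + ρ) ^ n * t := by positivity
      rw [pow_succ] at h4
      obtain ⟨i1, i2⟩ := ih _ ht1 (hc.le.trans h3) le_rfl
      obtain ⟨j1, j2⟩ := h.polar_step h0 h1 (α := α) (α' := α) hs0 hc.le h3 (by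
        have : t' * (1 - ρ) ≤ (1 + ρ) ^ n * (1 + ρ) * t * (1 - ρ) := by gcongr
        nlinarith [mul_pos hs0 (mul_pos h0 h0)]) (by simpa using hs0.le)
      constructor
      · calc _ ≤ _ := i1
          _ ≤ K ^ n * (K * _) := by gcongr
          _ = _ := by ring
      · calc _ ≤ _ := j2
          _ ≤ K * (K ^ n * _) := by gcongr
          _ = _ := by ring

end NearlyConstantOnTops

/-- A weight nearly constant on tops is nearly constant away from the circle in every box. -/
theorem exists_nearlyConstant {ρ : ℝ} (h0 : 0 < ρ) (h1 : ρ < 1) (K : ℝ) {κ : ℝ} (hκ : 0 < κ) :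
    ∃ K' : ℝ, 0 < K' ∧ ∀ w : ℂ → ℝ, IsWeight w → NearlyConstantOnTops ρ K w →
      ∀ J : Arc, ∀ z ∈ J.box, ∀ ξ ∈ J.box, κ * J.length ≤ 1 - ‖z‖ → κ * J.length ≤ 1 - ‖ξ‖ →
        w z ≤ K' * w ξ := by
  obtain ⟨m, hm⟩ := exists_nat_ge (1 / κ)
  obtain ⟨n, hn⟩ := pow_unbounded_of_one_lt (1 / κ) (by linarith : 1 < 1 + ρ)
  rw [div_le_iff₀ hκ] at hm
  rw [div_lt_iff₀ hκ] at hn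
  -- First `m` angular steps at depth `t`, then `n` radial steps. The constant is chosen before the
  -- weight, hence `max 1 K`; the existence of a weight forces `1 ≤ K`.
  refine ⟨max 1 K ^ m * max 1 K ^ n, by positivity, fun w hw h J z hz ξ hξ hz1 hξ1 => ?_⟩
  have hK := h.one_le h0 h1 hw
  rw [max_eq_right hK]
  obtain ⟨r, α, hr, hr1, hr2, hr3, rfl⟩ := hz
  obtain ⟨r', α', hr', hr1', hr2', hr3', rfl⟩ := hξ
  obtain ⟨t, rfl⟩ : ∃ t, r = 1 - t := ⟨1 - r, by ring⟩
  obtain ⟨t', rfl⟩ : ∃ t', r' = 1 - t' := ⟨1 - r', by ring⟩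
  rw [norm_one_sub_mul_exp (by linarith)] at hz1 hξ1
  have hl := J.length_pos
  have ht : 0 < t := by linarith
  have ht' : 0 < t' := by linarith
  have hbig : ∀ s, κ * J.length ≤ 1 - (1 - s) → ∀ c, 1 ≤ c * κ → J.length ≤ c * s := by
    intro s hs c hc
    have hc0 : 0 < c := by by_contra hcon; push Not at hcon; nlinarith
    calc J.length ≤ c * κ * J.length := le_mul_of_one_le_left hl.le hc
      _ = c * (κ * J.length) := by ring
      _ ≤ c * s := by gcongr; linarith
  have hang : |α - α'| ≤ m * t := by
    have := hbig t hz1 m hm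
    rw [abs_lt] at hr3 hr3'
    rw [abs_le]; constructor <;> linarith
  have b1 := h.polar_angular h0 h1 hw ht (by linarith) m α α' hang
  have b2 : w ((1 - t : ℝ) * Complex.exp (α' * Complex.I)) ≤
      K ^ n * w ((1 - t' : ℝ) * Complex.exp (α' * Complex.I)) := by
    rcases le_total t t' with hle | hle
    · exact (h.polar_radial h0 h1 hw ht α' n t' hle (by linarith)
        (by linarith [hbig t hz1 _ hn.le])).1
    · exact (h.polar_radial h0 h1 hw ht' α' n t hle (by linarith)
        (by linarith [hbig t' hξ1 _ hn.le])).2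
  calc _ ≤ _ := b1
    _ ≤ K ^ m * (K ^ n * _) := by gcongr
    _ = _ := by ring

/-! ### The measure `w dA` and comparison with box averages -/

/-- The measure `w dA` on the disk. -/
noncomputable def weightMeasure (w : ℂ → ℝ) : Measure ℂ :=
  (volume.restrict (Metric.ball 0 1)).withDensity fun z => ENNReal.ofReal (w z)

theorem weightMeasure_apply (w : ℂ → ℝ) {E : Set ℂ} (hE : E ⊆ Metric.ball 0 1) :
    weightMeasure w E = mass w E := by
  rw [weightMeasure, withDensity_apply', Measure.restrict_restrict' measurableSet_ball,
    inter_eq_left.2 hE, mass]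

theorem Arc.pbox_subset_ball (I : Arc) : I.pbox ⊆ Metric.ball 0 1 :=
  sdiff_subset.trans I.box_subset_ball

theorem weightMeasure_pbox (w : ℂ → ℝ) (I : Arc) : weightMeasure w I.pbox = mass w I.box := by
  rw [weightMeasure_apply w I.pbox_subset_ball, mass, mass, Measure.restrict_congr_set I.pbox_ae_eq]

theorem volume_pbox (I : Arc) : volume I.pbox = volume I.box := measure_congr I.pbox_ae_eq

namespace IsWeight

variable {w : ℂ → ℝ}

theorem aemeasurable (hw : IsWeight w) :
    AEMeasurable (fun z => ENNReal.ofReal (w z)) (volume.restrict (Metric.ball 0 1)) :=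
  hw.2.aestronglyMeasurable.aemeasurable.ennreal_ofReal

theorem aemeasurable_restrict (hw : IsWeight w) {E : Set ℂ} (hE : E ⊆ Metric.ball 0 1) :
    AEMeasurable (fun z => ENNReal.ofReal (w z)) (volume.restrict E) :=
  hw.aemeasurable.mono_measure (Measure.restrict_mono hE le_rfl)

theorem mass_ne_top (hw : IsWeight w) {E : Set ℂ} (hE : E ⊆ Metric.ball 0 1) : mass w E ≠ ⊤ := by
  have h1 : mass w (Metric.ball 0 1) < ⊤ := hw.2.lintegral_lt_top
  exact ((lintegral_mono_set hE).trans_lt h1).ne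

theorem mass_pos (hw : IsWeight w) (I : Arc) : 0 < mass w I.box := by
  refine pos_iff_ne_zero.2 fun h => ?_
  rw [mass, lintegral_eq_zero_iff' (hw.aemeasurable_restrict I.box_subset_ball)] at h
  have h2 : ∀ᵐ z ∂(volume.restrict I.box), False := by
    filter_upwards [h, ae_restrict_mem I.measurableSet_box] with z hz hzI
    have := hw.1 z (I.box_subset_ball hzI)
    simp at hz
    linarith
  rw [Filter.eventually_false_iff_eq_bot, ae_eq_bot, Measure.restrict_eq_zero] at h2
  exact I.volume_box_pos.ne' h2

theorem lintegral_weightMeasure (hw : IsWeight w) {E : Set ℂ} (hE : E ⊆ Metric.ball 0 1)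
    (hEm : MeasurableSet E) (g : ℂ → ℝ≥0∞) :
    ∫⁻ z in E, g z ∂(weightMeasure w) = ∫⁻ z in E, ENNReal.ofReal (w z) * g z := by
  rw [weightMeasure, restrict_withDensity hEm, Measure.restrict_restrict' measurableSet_ball,
    inter_eq_left.2 hE, lintegral_withDensity_eq_lintegral_mul_non_measurable₀ _
    (hw.aemeasurable_restrict hE) (Filter.Eventually.of_forall fun z => ENNReal.ofReal_lt_top)]
  rfl

theorem ae_weightMeasure (w : ℂ → ℝ) {p : ℂ → Prop} (h : ∀ᵐ z ∂volume, p z) :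
    ∀ᵐ z ∂(weightMeasure w), p z :=
  (withDensity_absolutelyContinuous _ _).ae_le (Measure.restrict_le_self.absolutelyContinuous.ae_le h)

end IsWeight

theorem isTree_pbox (I : Arc) : IsTree fun l => (I.sub l).pbox where
  subset b l := (I.sub l).pbox_child_subset b
  disjoint l := Arc.pbox_disjoint (I.sub l).child_disjoint

theorem isTree_toSet (I : Arc) : IsTree fun l => (I.sub l).toSet where
  subset b l := (I.sub l).child_toSet_subset b
  disjoint l := (I.sub l).child_disjoint

theorem volume_pbox_le_four_mul_child (I : Arc) (b : Bool) (l : List Bool) :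
    volume (I.sub l).pbox ≤ 4 * volume (I.sub (b :: l)).pbox := by
  rw [volume_pbox, volume_pbox]
  exact (I.sub l).volume_box_le_four_mul_child b

/-- On the top half of a box, a nearly constant weight is at most a multiple of its average. -/
theorem ofReal_mul_volume_le_mass {w : ℂ → ℝ} {K' : ℝ} (hK : 0 ≤ K') (J : Arc)
    (h : ∀ z ∈ J.box, ∀ ξ ∈ J.box, 1 / 4 * J.length ≤ 1 - ‖z‖ →
      1 / 4 * J.length ≤ 1 - ‖ξ‖ → w z ≤ K' * w ξ)
    {z : ℂ} (hz : z ∈ J.box) (ht : J.length / 2 ≤ 1 - ‖z‖) :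
    ENNReal.ofReal (w z) * volume J.box ≤ ENNReal.ofReal (4 * K') * mass w J.box := by
  have hl := J.length_pos
  have hl2 : J.length ≤ 2 := by linarith [norm_nonneg z]
  -- Depth `J.length / 4` rather than `J.length / 2`: the region must keep a quarter of the area of
  -- the box even as the length approaches 2, the largest value compatible with `ht`.
  set S := sector J.center J.length (max 0 (1 - J.length)) (1 - J.length / 4) with hS
  have hSm : MeasurableSet S := measurableSet_sector _ _ _ _
  have hSsub : S ⊆ J.box := by
    rw [J.box_eq_sector]
    rintro ξ ⟨a1, a2, a3⟩
    exact ⟨(le_max_right _ _).trans_lt a1, by linarith, a3⟩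
  have hvol : volume J.box ≤ 4 * volume S := by
    rw [J.volume_box_eq, hS, volume_sector J.length_le (le_max_left _ _)
      (max_le (by linarith) (by linarith)), show (4 : ℝ≥0∞) = ENNReal.ofReal 4 by norm_num,
      ← ENNReal.ofReal_mul (by norm_num)]
    apply ENNReal.ofReal_le_ofReal
    unfold area
    have : 1 - max 0 (1 - J.length) ^ 2 ≤
        4 * ((1 - J.length / 4) ^ 2 - max 0 (1 - J.length) ^ 2) := by
      rcases le_total 0 (1 - J.length) with h1 | h1
      · rw [max_eq_right h1]; nlinarith
      · rw [max_eq_left h1]; nlinarith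
    nlinarith
  have hint : ENNReal.ofReal (w z) * volume S ≤ ENNReal.ofReal K' * mass w S := by
    rw [mass, ← setLIntegral_const, ← lintegral_const_mul' _ _ ENNReal.ofReal_ne_top]
    refine setLIntegral_mono' hSm fun ξ hξ => ?_
    rw [← ENNReal.ofReal_mul hK]
    exact ENNReal.ofReal_le_ofReal (h z hz ξ (hSsub hξ) (by linarith) (by linarith [hξ.2.1]))
  calc ENNReal.ofReal (w z) * volume J.box ≤ ENNReal.ofReal (w z) * (4 * volume S) := by gcongr
    _ = 4 * (ENNReal.ofReal (w z) * volume S) := by ring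
    _ ≤ 4 * (ENNReal.ofReal K' * mass w J.box) := by
        exact mul_le_mul' le_rfl
          (hint.trans (mul_le_mul' le_rfl (lintegral_mono_set hSsub)))
    _ = _ := by
        rw [ENNReal.ofReal_mul (by norm_num)]; norm_num [mul_assoc]

theorem sq_le_area {ℓ : ℝ} (h : 0 < ℓ) (h' : ℓ ≤ 2 * Real.pi) : ℓ ^ 2 ≤ 16 * area ℓ := by
  unfold area
  have := Real.pi_lt_four
  rcases le_total 0 (1 - ℓ) with h1 | h1
  · rw [max_eq_right h1]; nlinarith [mul_pos h h, mul_nonneg (mul_pos h h).le h1]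
  · rw [max_eq_left h1]; nlinarith

/-- Under the smallness condition, a definite part of the mass of a box is away from the circle. -/
theorem SmallOnSubsets.exists_mass_le {w : ℂ → ℝ} (h : SmallOnSubsets w) (hw : IsWeight w) :
    ∃ κ : ℝ, 0 < κ ∧ κ ≤ 1 / 16 ∧ ∀ J : Arc,
      mass w J.box ≤ 2 * mass w (J.box ∩ {z | κ * J.length ≤ 1 - ‖z‖}) := by
  obtain ⟨δ, hδ, hs⟩ := h (1 / 2) (by norm_num) (by norm_num)
  -- The strip of depth `κ * J.length` has area at most `κ * J.length ^ 2`, so at most `16 * κ`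
  -- times the area of the box; `δ / 32` makes this smaller than `δ`. The bound `1 / 16` keeps the
  -- inner radius of the strip nonnegative, as lengths stay below 8.
  refine ⟨min (1 / 16) (δ / 32), by positivity, min_le_left _ _, fun J => ?_⟩
  set κ := min (1 / 16) (δ / 32) with hκ
  have hκ0 : 0 < κ := by positivity
  have hκ1 : κ ≤ 1 / 16 := min_le_left _ _
  have hκ2 : κ ≤ δ / 32 := min_le_right _ _
  have hl := J.length_pos
  have hl2 := J.length_le
  have hpi := Real.pi_lt_four
  have hmm : MeasurableSet {z : ℂ | κ * J.length ≤ 1 - ‖z‖} :=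
    measurableSet_le measurable_const (measurable_const.sub measurable_norm)
  set Ω := J.box ∩ {z | κ * J.length ≤ 1 - ‖z‖}ᶜ with hΩ
  have hsec : Ω ⊆ sector J.center J.length (1 - κ * J.length) 1 := by
    rintro z ⟨hz, hz2⟩
    rw [J.box_eq_sector] at hz
    have : ¬ (κ * J.length ≤ 1 - ‖z‖) := hz2
    push Not at this
    exact ⟨by linarith, hz.2⟩
  have hv : volume Ω / volume J.box < ENNReal.ofReal δ := by
    rw [ENNReal.div_lt_iff (Or.inl J.volume_box_pos.ne') (Or.inl J.volume_box_ne_top)]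
    refine (measure_mono hsec).trans_lt ?_
    rw [volume_sector hl2 (by nlinarith) (by nlinarith), J.volume_box_eq,
      ← ENNReal.ofReal_mul hδ.le, ENNReal.ofReal_lt_ofReal_iff (mul_pos hδ (area_pos hl))]
    have ha := sq_le_area hl hl2
    have hap := area_pos hl
    calc J.length * (1 ^ 2 - (1 - κ * J.length) ^ 2) / 2 ≤ κ * J.length ^ 2 := by
          nlinarith [mul_pos hl (mul_pos (mul_pos hκ0 hl) (mul_pos hκ0 hl))]
      _ ≤ κ * (16 * area J.length) := by gcongr
      _ < δ * area J.length := by nlinarith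
  have h1 := hs J Ω (J.measurableSet_box.inter hmm.compl).nullMeasurableSet inter_subset_left hv
  have h2 : mass w J.box = mass w (J.box ∩ {z | κ * J.length ≤ 1 - ‖z‖}) + mass w Ω := by
    rw [mass, ← lintegral_inter_add_sdiff _ _ hmm]; rfl
  have hfin : mass w J.box ≠ ⊤ := hw.mass_ne_top J.box_subset_ball
  clear_value Ω
  generalize mass w J.box = m at *
  generalize mass w (J.box ∩ {z | κ * J.length ≤ 1 - ‖z‖}) = x at *
  generalize mass w Ω = y at *
  have hx : x ≠ ⊤ := ne_top_of_le_ne_top hfin (h2 ▸ le_self_add)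
  have hy : y ≠ ⊤ := ne_top_of_le_ne_top hfin (h2 ▸ le_add_self)
  lift m to NNReal using hfin
  lift x to NNReal using hx
  lift y to NNReal using hy
  rw [show ENNReal.ofReal (1 / 2) = ((1 / 2 : NNReal) : ℝ≥0∞) by
    rw [ENNReal.ofReal, Real.toNNReal_div (by norm_num)]; simp] at h1
  norm_cast at *
  rw [← NNReal.coe_lt_coe] at h1
  rw [← NNReal.coe_le_coe]
  have h3 : (m : ℝ) = x + y := by rw [h2]; simp
  push_cast at *
  linarith

/-- At least half of the mass sits where `w` is at most `K' * w z`. This is the lower pointwise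
bound for `w`, converse to `ofReal_mul_volume_le_mass`. -/
theorem mass_le_mul_ofReal_mul_volume {w : ℂ → ℝ} {K' κ : ℝ} (hK : 0 ≤ K') (J : Arc)
    (h : ∀ z ∈ J.box, ∀ ξ ∈ J.box, κ * J.length ≤ 1 - ‖z‖ →
      κ * J.length ≤ 1 - ‖ξ‖ → w z ≤ K' * w ξ)
    (hm : mass w J.box ≤ 2 * mass w (J.box ∩ {z | κ * J.length ≤ 1 - ‖z‖}))
    {z : ℂ} (hz : z ∈ J.box) (ht : κ * J.length ≤ 1 - ‖z‖) :
    mass w J.box ≤ ENNReal.ofReal (2 * K') * ENNReal.ofReal (w z) * volume J.box := by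
  have hmm : MeasurableSet {z : ℂ | κ * J.length ≤ 1 - ‖z‖} :=
    measurableSet_le measurable_const (measurable_const.sub measurable_norm)
  refine hm.trans ?_
  rw [ENNReal.ofReal_mul zero_le_two, mul_assoc, mul_assoc]
  norm_num
  gcongr
  calc mass w (J.box ∩ {z | κ * J.length ≤ 1 - ‖z‖})
      ≤ ∫⁻ _ in J.box ∩ {z | κ * J.length ≤ 1 - ‖z‖}, ENNReal.ofReal (K' * w z) := by
        refine setLIntegral_mono' (J.measurableSet_box.inter hmm) fun ξ hξ => ?_
        exact ENNReal.ofReal_le_ofReal (h ξ hξ.1 z hz hξ.2 ht)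
    _ = ENNReal.ofReal (K' * w z) * volume (J.box ∩ {z | κ * J.length ≤ 1 - ‖z‖}) :=
        setLIntegral_const _ _
    _ ≤ ENNReal.ofReal (K' * w z) * volume J.box := by gcongr; exact inter_subset_left
    _ = _ := by rw [ENNReal.ofReal_mul hK, mul_assoc]

/-- Doubling of `w dA` on the tree: the child contains a region of depth at least `κ * J.length`
with a sixteenth of the area of `J.box`, and there `w` is bounded below by a multiple of the average
over `J.box`. -/
theorem mass_le_mul_mass_child {w : ℂ → ℝ} {K' κ : ℝ} (hκ0 : 0 < κ)
    (hκ1 : κ ≤ 1 / 16) (J : Arc)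
    (h : ∀ z ∈ J.box, κ * J.length ≤ 1 - ‖z‖ →
      mass w J.box ≤ ENNReal.ofReal K' * ENNReal.ofReal (w z) * volume J.box) (b : Bool) :
    mass w J.box ≤ ENNReal.ofReal K' * 16 * mass w (J.child b).box := by
  have hl := J.length_pos
  have hl2 := J.length_le
  have hpi := Real.pi_lt_d2
  set I := J.child b with hI
  have hIl : I.length = J.length / 2 := rfl
  have hIJ : I.box ⊆ J.box := Arc.box_subset_of_toSet_subset (J.child_toSet_subset b)
  set S := sector I.center I.length (max 0 (1 - I.length)) (1 - κ * J.length) with hS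
  have hSm : MeasurableSet S := measurableSet_sector _ _ _ _
  have hκl : κ * J.length ≤ J.length / 16 := by nlinarith
  have hSsub : S ⊆ I.box := by
    rw [I.box_eq_sector]
    rintro ξ ⟨a1, a2, a3⟩
    exact ⟨(le_max_right _ _).trans_lt a1, by nlinarith, a3⟩
  have hvol : volume J.box ≤ 16 * volume S := by
    rw [J.volume_box_eq, hS, volume_sector I.length_le (le_max_left _ _)
      (max_le (by linarith) (by linarith)), show (16 : ℝ≥0∞) = ENNReal.ofReal 16 by norm_num,
      ← ENNReal.ofReal_mul (by norm_num), hIl]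
    apply ENNReal.ofReal_le_ofReal
    unfold area
    have h0 : (1 - J.length / 16) ^ 2 ≤ (1 - κ * J.length) ^ 2 :=
      pow_le_pow_left₀ (by linarith) (by linarith) 2
    have : 1 - max 0 (1 - J.length) ^ 2 ≤
        8 * ((1 - J.length / 16) ^ 2 - max 0 (1 - J.length / 2) ^ 2) := by
      rcases le_total 0 (1 - J.length / 2) with h1 | h1
      · rw [max_eq_right h1]
        rcases le_total 0 (1 - J.length) with h2 | h2
        · rw [max_eq_right h2]; nlinarith
        · rw [max_eq_left h2]; nlinarith
      · rw [max_eq_left h1, max_eq_left (by linarith)]; nlinarith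
    nlinarith
  have hint : mass w J.box * volume S ≤ ENNReal.ofReal K' * volume J.box * mass w S := by
    rw [mass, mass, ← setLIntegral_const, ← lintegral_const_mul' _ _
      (ENNReal.mul_ne_top ENNReal.ofReal_ne_top J.volume_box_ne_top)]
    refine setLIntegral_mono' hSm fun ξ hξ => ?_
    refine (h ξ (hIJ (hSsub hξ)) (by linarith [hξ.2.1])).trans_eq (by ring)
  have hfin : mass w J.box * volume J.box ≤
      (ENNReal.ofReal K' * 16 * mass w I.box) * volume J.box :=
    calc mass w J.box * volume J.box ≤ mass w J.box * (16 * volume S) := by gcongr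
      _ = 16 * (mass w J.box * volume S) := by ring
      _ ≤ 16 * (ENNReal.ofReal K' * volume J.box * mass w I.box) := by
          exact mul_le_mul' le_rfl
            (hint.trans (mul_le_mul' le_rfl (lintegral_mono_set hSsub)))
      _ = _ := by ring
  exact (ENNReal.mul_le_mul_iff_left J.volume_box_pos.ne' J.volume_box_ne_top).1 hfin

/-! ### The maximal function over Carleson boxes -/

theorem lt_setLAverage_iff (J : Arc) (f : ℂ → ℝ≥0∞) (t : ℝ≥0∞) :
    t < ⨍⁻ ξ in J.box, f ξ ∂volume ↔ t * volume J.box < ∫⁻ ξ in J.box, f ξ := by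
  rw [setLAverage_eq, ENNReal.lt_div_iff_mul_lt (Or.inl J.volume_box_pos.ne')
    (Or.inl J.volume_box_ne_top)]

/-- A set containing every box whose arc meets `J` and has at most twice its length. -/
theorem Arc.exists_enlargement (J : Arc) : ∃ S : Set ℂ, volume S ≤ 25 * volume J.box ∧
    ∀ I : Arc, (I.toSet ∩ J.toSet).Nonempty → I.length ≤ 2 * J.length → I.box ⊆ S := by
  have hl := J.length_pos
  -- An arc meeting `J` of length at most twice that of `J` lies within angle `5 / 2 * J.length` of
  -- its centre. If five times the length exceeds the circle, the whole disk serves.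
  by_cases h5 : 5 * J.length ≤ 2 * Real.pi
  · let J' : Arc := ⟨J.center, 5 * J.length, by linarith, h5⟩
    refine ⟨J'.box, ?_, fun I hIJ hle => ?_⟩
    · rw [J'.volume_box_eq, J.volume_box_eq, show (25 : ℝ≥0∞) = ENNReal.ofReal 25 by norm_num,
        ← ENNReal.ofReal_mul (by norm_num)]
      apply ENNReal.ofReal_le_ofReal
      have := area_mul_le hl (by norm_num : (1 : ℝ) ≤ 5)
      norm_num at this
      exact this
    · obtain ⟨ζ, ⟨α₀, hα₀, rfl⟩, β₀, hβ₀, he⟩ := hIJ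
      obtain ⟨m, hm⟩ := Circle.exp_eq_exp.1 he
      rintro z ⟨r, α, hr, h1, h2, h3, rfl⟩
      refine ⟨r, α - m * (2 * Real.pi), hr, ?_, h2, ?_, ?_⟩
      · show 1 - 5 * J.length < r; linarith
      · show |J.center - (α - m * (2 * Real.pi))| < 5 * J.length / 2
        rw [abs_lt] at *
        constructor <;> linarith
      · congr 1
        rw [Complex.exp_eq_exp_iff_exists_int]
        exact ⟨m, by push_cast; ring⟩
  · push Not at h5
    refine ⟨Metric.ball 0 1, ?_, fun I _ _ => I.box_subset_ball⟩
    have hpi := Real.pi_gt_three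
    rw [Complex.volume_ball, J.volume_box_eq, show (25 : ℝ≥0∞) = ENNReal.ofReal 25 by norm_num,
      ← ENNReal.ofReal_mul (by norm_num), ENNReal.ofReal_one, one_pow, one_mul,
      ← ENNReal.ofReal_coe_nnreal]
    apply ENNReal.ofReal_le_ofReal
    unfold area
    rw [max_eq_left (by linarith)]
    simp only [NNReal.coe_real_pi]
    linarith

/-- The weak type `(1, 1)` bound for the maximal function over Carleson boxes. -/
theorem mul_volume_maximal_le (f : ℂ → ℝ≥0∞) (t : ℝ≥0∞) :
    t * volume {z | t < maximal f z} ≤ 25 * ∫⁻ z, f z := by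
  set T : Set Arc := {J | t * volume J.box < ∫⁻ ξ in J.box, f ξ} with hT
  -- Vitali selection is done for arcs; disjointness passes to the punctured boxes, and countability
  -- follows from their positive areas in a disk of finite area.
  obtain ⟨u, huT, hu, hcov⟩ := Vitali.exists_disjoint_subfamily_covering_enlargement
    Arc.toSet T Arc.length 2 one_lt_two (fun J _ => J.length_pos.le) (2 * Real.pi)
    (fun J _ => J.length_le) (fun J _ => ⟨Circle.exp J.center, J.center, by
      simpa using J.length_pos, rfl⟩)
  have hdis : u.PairwiseDisjoint Arc.pbox := fun I hI J hJ hne => Arc.pbox_disjoint (hu hI hJ hne)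
  have hcount : u.Countable := by
    have h1 : ∀ J : u, volume (J : Arc).pbox ≠ 0 := fun J => by
      rw [volume_pbox]; exact (J : Arc).volume_box_pos.ne'
    have h2 : Set.Countable {J : u | 0 < volume (J : Arc).pbox} :=
      Measure.countable_meas_pos_of_disjoint_of_meas_iUnion_ne_top volume
        (fun J : u => (J : Arc).measurableSet_pbox)
        (fun I J hne => hdis I.2 J.2 (fun h => hne (Subtype.ext h)))
        (ne_top_of_le_ne_top measure_ball_lt_top.ne
          (measure_mono (iUnion_subset fun J : u => (J : Arc).pbox_subset_ball)))
    have h3 : {J : u | 0 < volume (J : Arc).pbox} = univ :=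
      eq_univ_of_forall fun J => pos_iff_ne_zero.2 (h1 J)
    rw [h3] at h2
    exact countable_coe_iff.1 (countable_univ_iff.1 h2)
  choose S hS1 hS2 using Arc.exists_enlargement
  have hsub : {z | t < maximal f z} ⊆ ⋃ J ∈ u, S J := by
    intro z hz
    have hz' : t < maximal f z := hz
    rw [maximal] at hz'
    simp only [lt_iSup_iff] at hz'
    obtain ⟨J, hzJ, hJ⟩ := hz'
    obtain ⟨b, hb, hne, hle⟩ := hcov J ((lt_setLAverage_iff J f t).1 hJ)
    exact mem_biUnion hb (hS2 b J hne hle hzJ)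
  have hlint : ∀ J : Arc, ∫⁻ ξ in J.box, f ξ = ∫⁻ ξ in J.pbox, f ξ := fun J => by
    rw [Measure.restrict_congr_set J.pbox_ae_eq]
  have := hcount.to_subtype
  calc t * volume {z | t < maximal f z} ≤ t * ∑' J : u, volume (S J) := by
        gcongr; exact (measure_mono hsub).trans (measure_biUnion_le _ hcount _)
    _ = ∑' J : u, t * volume (S J) := ENNReal.tsum_mul_left.symm
    _ ≤ ∑' J : u, 25 * ∫⁻ ξ in (J : Arc).pbox, f ξ := by
        refine ENNReal.tsum_le_tsum fun J => ?_
        calc t * volume (S J) ≤ t * (25 * volume (J : Arc).box) := by gcongr; exact hS1 _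
          _ = 25 * (t * volume (J : Arc).box) := by ring
          _ ≤ 25 * ∫⁻ ξ in (J : Arc).pbox, f ξ := by
            rw [← hlint]
            exact mul_le_mul' le_rfl (le_of_lt (huT J.2))
    _ = 25 * ∫⁻ ξ in ⋃ J ∈ u, J.pbox, f ξ := by
        rw [ENNReal.tsum_mul_left, lintegral_biUnion hcount
          (fun J _ => J.measurableSet_pbox) hdis]
    _ ≤ 25 * ∫⁻ z, f z := mul_le_mul' le_rfl (setLIntegral_le_lintegral _ _)

theorem maximal_le_maximal_indicator_add (f : ℂ → ℝ≥0∞) (c : ℝ≥0∞) (z : ℂ) :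
    maximal f z ≤ maximal ({ξ | c < f ξ}.indicator f) z + c := by
  refine iSup₂_le fun J hz => ?_
  have h1 : ∫⁻ ξ in J.box, f ξ ≤
      (∫⁻ ξ in J.box, {ξ | c < f ξ}.indicator f ξ) + c * volume J.box := by
    rw [← setLIntegral_const, ← lintegral_add_right _ measurable_const]
    refine lintegral_mono fun ξ => ?_
    by_cases h : c < f ξ
    · simp only [indicator_of_mem (show ξ ∈ {ξ | c < f ξ} from h)]; exact le_self_add
    · exact (not_lt.1 h).trans le_add_self
  have h2 : ⨍⁻ ξ in J.box, f ξ ∂volume ≤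
      (⨍⁻ ξ in J.box, {ξ | c < f ξ}.indicator f ξ ∂volume) + c := by
    rw [setLAverage_eq, setLAverage_eq]
    refine (ENNReal.div_le_div_right h1 _).trans ?_
    rw [ENNReal.add_div, ENNReal.mul_div_cancel_right J.volume_box_pos.ne' J.volume_box_ne_top]
  refine h2.trans ?_
  gcongr
  exact le_iSup₂ (f := fun (J : Arc) (_ : z ∈ J.box) =>
    ⨍⁻ ξ in J.box, {ξ | c < f ξ}.indicator f ξ ∂volume) J hz

/-- The part of `f` below `c` contributes at most `c` to the maximal function, so only the part
above `c` needs the weak type bound. -/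
theorem mul_volume_two_mul_lt_maximal_le (f : ℂ → ℝ≥0∞) {c : ℝ≥0∞} (hc : c ≠ ⊤) :
    c * volume {z | 2 * c < maximal f z} ≤ 25 * ∫⁻ z, {ξ | c < f ξ}.indicator f z := by
  refine le_trans (mul_le_mul' le_rfl (measure_mono fun z hz => ?_))
    (mul_volume_maximal_le ({ξ | c < f ξ}.indicator f) c)
  have h1 : 2 * c < maximal f z := hz
  have h2 := h1.trans_le (maximal_le_maximal_indicator_add f c z)
  rw [two_mul] at h2
  exact (ENNReal.add_lt_add_iff_right hc).1 h2

/-! ### From `L log L` to Fujii–Wilson -/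

/-- Partial sums increase only at indices satisfying `p`, so it is enough to bound them there. -/
theorem tsum_ite_le {p : ℕ → Prop} [DecidablePred p] {g : ℕ → ℝ≥0∞} {x : ℝ≥0∞}
    (h : ∀ n, p n → ∑ k ∈ Finset.range (n + 1), g k ≤ x) :
    ∑' k, (if p k then g k else 0) ≤ x := by
  refine ENNReal.tsum_le_of_sum_range_le fun n => ?_
  induction n with
  | zero => simp
  | succ n ih =>
    by_cases hp : p n
    · refine le_trans (Finset.sum_le_sum fun k _ => ?_) (h n hp)
      split_ifs
      · exact le_rfl
      · exact zero_le
    · rw [Finset.sum_range_succ, if_neg hp, add_zero]; exact ih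

theorem sum_range_two_pow_mul_le (c : ℝ≥0∞) (n : ℕ) :
    ∑ k ∈ Finset.range n, 2 ^ k * c ≤ 2 ^ n * c := by
  induction n with
  | zero => simp
  | succ n ih =>
    rw [Finset.sum_range_succ, pow_succ, mul_two, add_mul]
    gcongr

/-- Dyadic layer cake: the last level passed by `x` already accounts for `x`, and infinitely many
passed levels make the sum infinite. -/
theorem le_add_tsum_dyadic {a x : ℝ≥0∞} (ha : a ≠ 0) :
    x ≤ 2 * a + ∑' k : ℕ, (if 2 * (2 ^ k * a) < x then 4 * (2 ^ k * a) else 0) := by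
  classical
  by_cases h0 : x ≤ 2 * a
  · exact h0.trans le_self_add
  push Not at h0
  by_cases hex : ∃ k : ℕ, x ≤ 2 * (2 ^ k * a)
  · obtain ⟨k, hk⟩ : ∃ k, Nat.find hex = k + 1 :=
      Nat.exists_eq_succ_of_ne_zero fun h => by
        have := Nat.find_spec hex
        rw [h] at this
        simp at this
        exact absurd h0 (not_lt.2 this)
    have hk1 : x ≤ 2 * (2 ^ (k + 1) * a) := hk ▸ Nat.find_spec hex
    have hk2 : 2 * (2 ^ k * a) < x := not_le.1 (Nat.find_min hex (by omega : k < Nat.find hex))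
    calc x ≤ 2 * (2 ^ (k + 1) * a) := hk1
      _ = if 2 * (2 ^ k * a) < x then 4 * (2 ^ k * a) else 0 := by rw [if_pos hk2]; ring
      _ ≤ ∑' k : ℕ, (if 2 * (2 ^ k * a) < x then 4 * (2 ^ k * a) else 0) :=
          ENNReal.le_tsum (f := fun k : ℕ => if 2 * (2 ^ k * a) < x then 4 * (2 ^ k * a) else 0) k
      _ ≤ _ := le_add_self
  · push Not at hex
    have : ∑' k : ℕ, (if 2 * (2 ^ k * a) < x then 4 * (2 ^ k * a) else 0) = ⊤ := by
      rw [eq_top_iff, ← ENNReal.tsum_const_eq_top_of_ne_zero (α := ℕ) ha]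
      refine ENNReal.tsum_le_tsum fun k => ?_
      rw [if_pos (hex k), ← mul_assoc]
      refine le_mul_of_one_le_left zero_le (one_le_mul ?_ (one_le_pow₀ one_le_two))
      norm_num
    rw [this]; simp

/-- The average of `w` over the box of `I`. -/
noncomputable def boxAverage (w : ℂ → ℝ) (I : Arc) : ℝ :=
  (mass w I.box).toReal / (volume I.box).toReal

variable {w : ℂ → ℝ}

theorem boxAverage_pos (hw : IsWeight w) (I : Arc) : 0 < boxAverage w I :=
  div_pos (ENNReal.toReal_pos (hw.mass_pos I).ne' (hw.mass_ne_top I.box_subset_ball))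
    (ENNReal.toReal_pos I.volume_box_pos.ne' I.volume_box_ne_top)

theorem ofReal_boxAverage (hw : IsWeight w) (I : Arc) :
    ENNReal.ofReal (boxAverage w I) = mass w I.box / volume I.box := by
  rw [boxAverage, ENNReal.ofReal_div_of_pos
    (ENNReal.toReal_pos I.volume_box_pos.ne' I.volume_box_ne_top),
    ENNReal.ofReal_toReal (hw.mass_ne_top I.box_subset_ball),
    ENNReal.ofReal_toReal I.volume_box_ne_top]

theorem ofReal_boxAverage_mul (hw : IsWeight w) (I : Arc) :
    ENNReal.ofReal (boxAverage w I) * volume I.box = mass w I.box := by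
  rw [ofReal_boxAverage hw, ENNReal.div_mul_cancel I.volume_box_pos.ne' I.volume_box_ne_top]

theorem setLAverage_eq_boxAverage (hw : IsWeight w) (I : Arc) :
    ⨍⁻ z in I.box, ENNReal.ofReal (w z) ∂volume = ENNReal.ofReal (boxAverage w I) := by
  rw [setLAverage_eq, ofReal_boxAverage hw]; rfl

theorem llogLBound_iff {C : ℝ} : LLogLBound w C ↔ ∀ I : Arc,
    ∫⁻ z in I.box, ENNReal.ofReal (w z * Real.log (Real.exp 1 + w z / boxAverage w I)) ≤
      ENNReal.ofReal C * mass w I.box := by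
  have : ∀ (I : Arc) (x : ℝ), x * (volume I.box).toReal / (mass w I.box).toReal =
      x / boxAverage w I := fun I x => by rw [boxAverage, div_div_eq_mul_div]
  unfold LLogLBound
  simp_rw [this]

theorem one_le_log_exp_add {x : ℝ} (hx : 0 ≤ x) : 1 ≤ Real.log (Real.exp 1 + x) := by
  rw [Real.le_log_iff_exp_le (by positivity)]; linarith

/-- Each doubling of `a` below `x` costs `log 2` in the logarithm. The factor 3 covers `1 / log 2`
and the extra level `k = 0`. -/
theorem tsum_two_pow_mul_lt_le {x a : ℝ} (hx : 0 < x) (ha : 0 < a) :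
    ∑' k : ℕ, (if 2 ^ k * ENNReal.ofReal a < ENNReal.ofReal x then (1 : ℝ≥0∞) else 0) ≤
      ENNReal.ofReal (3 * Real.log (Real.exp 1 + x / a)) := by
  refine tsum_ite_le fun n hn => ?_
  rw [Finset.sum_const, Finset.card_range, nsmul_eq_mul, mul_one, ← ENNReal.ofReal_natCast]
  apply ENNReal.ofReal_le_ofReal
  rw [show (2 : ℝ≥0∞) ^ n = ENNReal.ofReal (2 ^ n) by rw [ENNReal.ofReal_pow zero_le_two]; simp,
    ← ENNReal.ofReal_mul (by positivity), ENNReal.ofReal_lt_ofReal_iff hx, ← lt_div_iff₀ ha] at hn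
  have h1 : n * Real.log 2 ≤ Real.log (Real.exp 1 + x / a) := by
    rw [← Real.log_pow]
    exact Real.log_le_log (by positivity) (by linarith [Real.exp_pos 1])
  have h2 := one_le_log_exp_add (div_pos hx ha).le
  have h3 := Real.log_two_gt_d9
  have hn0 : (0 : ℝ) ≤ n := Nat.cast_nonneg n
  push_cast
  nlinarith

/-- Integrate the dyadic layer cake of the maximal function and apply the truncated weak type bound
at each level `2 ^ k * a`. A point is then counted once per level below `w`, which produces the
logarithm. The constant is `4 * 25 * 3 = 300`. -/
theorem lintegral_maximal_le (hw : IsWeight w) {C : ℝ} (h : LLogLBound w C) (I : Arc) :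
    ∫⁻ z in I.box, maximal (I.box.indicator fun ξ => ENNReal.ofReal (w ξ)) z ≤
      (2 + 300 * ENNReal.ofReal C) * mass w I.box := by
  classical
  rw [llogLBound_iff] at h
  set f : ℂ → ℝ≥0∞ := I.box.indicator fun ξ => ENNReal.ofReal (w ξ) with hf
  have hA := boxAverage_pos hw I
  set a : ℝ≥0∞ := ENNReal.ofReal (boxAverage w I) with ha
  have ha0 : a ≠ 0 := (ENNReal.ofReal_pos.2 hA).ne'
  have hat : a ≠ ⊤ := ENNReal.ofReal_ne_top
  -- Measurable hulls replace the superlevel sets, so measurability of the maximal function is not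
  -- needed.
  set F : ℕ → Set ℂ := fun k => toMeasurable volume {z | 2 * (2 ^ k * a) < maximal f z} with hF
  have hFm : ∀ k, MeasurableSet (F k) := fun k => measurableSet_toMeasurable _ _
  have hpt : ∀ z, maximal f z ≤ 2 * a + ∑' k : ℕ, 4 * (2 ^ k * a) * (F k).indicator 1 z := by
    intro z
    refine (le_add_tsum_dyadic (x := maximal f z) ha0).trans ?_
    gcongr with k
    split_ifs with hk
    · have hk' : z ∈ F k :=
        subset_toMeasurable volume {z | 2 * (2 ^ k * a) < maximal f z} hk
      rw [indicator_of_mem hk', Pi.one_apply, mul_one]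
    · exact zero_le
  have hmeas : ∀ k : ℕ, Measurable fun z => 4 * (2 ^ k * a) * (F k).indicator (1 : ℂ → ℝ≥0∞) z :=
    fun k => (measurable_one.indicator (hFm k)).const_mul _
  have hterm : ∀ k : ℕ, ∫⁻ z in I.box, 4 * (2 ^ k * a) * (F k).indicator 1 z ≤
      100 * ∫⁻ z in I.box, ENNReal.ofReal (w z) *
        (if 2 ^ k * a < ENNReal.ofReal (w z) then 1 else 0) := by
    intro k
    have h1 := mul_volume_two_mul_lt_maximal_le f (c := 2 ^ k * a)
      (ENNReal.mul_ne_top (by simp) hat)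
    have h2 : ∫⁻ z, {ξ | 2 ^ k * a < f ξ}.indicator f z = ∫⁻ z in I.box, ENNReal.ofReal (w z) *
        (if 2 ^ k * a < ENNReal.ofReal (w z) then 1 else 0) := by
      rw [← lintegral_indicator I.measurableSet_box]
      congr 1
      ext z
      by_cases hz : z ∈ I.box
      · rw [indicator_of_mem hz]
        by_cases h3 : 2 ^ k * a < f z
        · rw [indicator_of_mem (show z ∈ {ξ | 2 ^ k * a < f ξ} from h3)]
          rw [hf, indicator_of_mem hz] at h3 ⊢
          rw [if_pos h3, mul_one]
        · rw [indicator_of_notMem (show z ∉ {ξ | 2 ^ k * a < f ξ} from h3)]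
          rw [hf, indicator_of_mem hz] at h3
          rw [if_neg h3, mul_zero]
      · have h3 : f z = 0 := by rw [hf, indicator_of_notMem hz]
        rw [indicator_of_notMem hz, indicator_of_notMem]
        simp [h3]
    calc ∫⁻ z in I.box, 4 * (2 ^ k * a) * (F k).indicator 1 z
        ≤ 4 * (2 ^ k * a) * volume (F k) := by
          rw [lintegral_const_mul _ (measurable_one.indicator (hFm k)),
            lintegral_indicator_one (hFm k)]
          exact mul_le_mul' le_rfl (Measure.restrict_apply_le _ _)
      _ = 4 * ((2 ^ k * a) * volume {z | 2 * (2 ^ k * a) < maximal f z}) := by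
          rw [hF, measure_toMeasurable]; ring
      _ ≤ 4 * (25 * ∫⁻ z, {ξ | 2 ^ k * a < f ξ}.indicator f z) := by gcongr
      _ = _ := by rw [h2, ← mul_assoc]; norm_num
  have hW := hw.aemeasurable_restrict I.box_subset_ball
  have hsum : ∑' k : ℕ, ∫⁻ z in I.box, ENNReal.ofReal (w z) *
        (if 2 ^ k * a < ENNReal.ofReal (w z) then 1 else 0) ≤
        3 * (ENNReal.ofReal C * mass w I.box) := by
    have hWm : ∀ k : ℕ, AEMeasurable (fun z => ENNReal.ofReal (w z) *
        (if 2 ^ k * a < ENNReal.ofReal (w z) then (1 : ℝ≥0∞) else 0)) (volume.restrict I.box) := by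
      intro k
      have hg : Measurable fun x : ℝ≥0∞ => x * (if 2 ^ k * a < x then (1 : ℝ≥0∞) else 0) :=
        measurable_id.mul (Measurable.ite measurableSet_Ioi measurable_const measurable_const)
      exact hg.comp_aemeasurable hW
    rw [← lintegral_tsum hWm]
    refine le_trans ?_ (mul_le_mul' le_rfl (h I))
    rw [← lintegral_const_mul' _ _ (by norm_num)]
    refine setLIntegral_mono' I.measurableSet_box fun z hz => ?_
    have hz0 := hw.1 z (I.box_subset_ball hz)
    rw [ENNReal.tsum_mul_left, show (3 : ℝ≥0∞) = ENNReal.ofReal 3 by norm_num,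
      ← ENNReal.ofReal_mul (by norm_num), mul_left_comm, ENNReal.ofReal_mul hz0.le]
    gcongr
    exact tsum_two_pow_mul_lt_le hz0 hA
  calc ∫⁻ z in I.box, maximal f z
      ≤ ∫⁻ z in I.box, (2 * a + ∑' k : ℕ, 4 * (2 ^ k * a) * (F k).indicator 1 z) :=
        lintegral_mono hpt
    _ = 2 * a * volume I.box + ∑' k : ℕ, ∫⁻ z in I.box, 4 * (2 ^ k * a) * (F k).indicator 1 z := by
        rw [lintegral_add_left measurable_const, setLIntegral_const,
          lintegral_tsum fun k => (hmeas k).aemeasurable]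
    _ ≤ 2 * mass w I.box + 100 * (3 * (ENNReal.ofReal C * mass w I.box)) := by
        rw [mul_assoc, ofReal_boxAverage_mul hw]
        gcongr
        refine (ENNReal.tsum_le_tsum hterm).trans ?_
        rw [ENNReal.tsum_mul_left]
        gcongr
    _ = _ := by ring

theorem bInfty_lt_top_of_llogL (hw : IsWeight w) {C : ℝ} (h : LLogLBound w C) : BInfty w < ⊤ := by
  refine lt_of_le_of_lt (iSup_le fun I => ?_)
    (show (2 + 300 * ENNReal.ofReal C : ℝ≥0∞) < ⊤ from ENNReal.add_lt_top.2
      ⟨by norm_num, ENNReal.mul_lt_top (by norm_num) ENNReal.ofReal_lt_top⟩)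
  exact ENNReal.div_le_of_le_mul (lintegral_maximal_le hw h I)

/-! ### From Fujii–Wilson to `L log L` -/

theorem mass_le_maximal (hw : IsWeight w) (I : Arc) :
    mass w I.box ≤ ∫⁻ z in I.box, maximal (I.box.indicator fun ξ => ENNReal.ofReal (w ξ)) z := by
  rw [← ofReal_boxAverage_mul hw, ← setLIntegral_const]
  refine setLIntegral_mono' I.measurableSet_box fun z hz => ?_
  refine le_trans (le_of_eq ?_) (le_iSup₂ (f := fun (J : Arc) (_ : z ∈ J.box) =>
    ⨍⁻ ξ in J.box, I.box.indicator (fun ξ => ENNReal.ofReal (w ξ)) ξ ∂volume) I hz)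
  rw [ofReal_boxAverage hw, setLAverage_eq, setLIntegral_indicator I.measurableSet_box, inter_self]
  rfl

/-- On a box the maximal function is at least the average over that box. The bound serves to absorb
an additive mass term into one proportional to `BInfty w`. -/
theorem one_le_bInfty (hw : IsWeight w) : 1 ≤ BInfty w := by
  let I : Arc := ⟨0, 1, one_pos, by linarith [Real.pi_gt_three]⟩
  refine le_trans ?_ (le_iSup _ I)
  rw [ENNReal.le_div_iff_mul_le (Or.inl (hw.mass_pos I).ne')
    (Or.inl (hw.mass_ne_top I.box_subset_ball)), one_mul]
  exact mass_le_maximal hw I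

theorem lintegral_maximal_le_bInfty (hw : IsWeight w) (I : Arc) :
    ∫⁻ z in I.box, maximal (I.box.indicator fun ξ => ENNReal.ofReal (w ξ)) z ≤
      BInfty w * mass w I.box := by
  rw [← ENNReal.div_le_iff (hw.mass_pos I).ne' (hw.mass_ne_top I.box_subset_ball)]
  exact le_iSup (fun I : Arc => (∫⁻ z in I.box,
    maximal (I.box.indicator fun ξ => ENNReal.ofReal (w ξ)) z) / mass w I.box) I

theorem lt_maximal_of_mem_superlevel (I : Arc) {t : ℝ≥0∞} {z : ℂ}
    (hz : z ∈ superlevel (fun l => (I.sub l).pbox) volume (weightMeasure w) t) :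
    t < maximal (I.box.indicator fun ξ => ENNReal.ofReal (w ξ)) z := by
  obtain ⟨l, hl, hzl⟩ := mem_iUnion₂.1 hz
  have h1 : t * volume (I.sub l).pbox < weightMeasure w (I.sub l).pbox := hl.1
  rw [volume_pbox, weightMeasure_pbox] at h1
  refine lt_of_lt_of_le ((lt_setLAverage_iff (I.sub l)
    (I.box.indicator fun ξ => ENNReal.ofReal (w ξ)) t).2 ?_)
    (le_iSup₂ (f := fun (J : Arc) (_ : z ∈ J.box) =>
    ⨍⁻ ξ in J.box, I.box.indicator (fun ξ => ENNReal.ofReal (w ξ)) ξ ∂volume) (I.sub l) hzl.1)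
  rw [setLIntegral_indicator I.measurableSet_box,
    inter_eq_right.2 (Arc.box_subset_of_toSet_subset (I.sub_toSet_subset l))]
  exact h1

/-- Near constancy in the form used by the stopping argument. -/
theorem ae_exists_mul_volume_le {K' : ℝ} (hK : 0 ≤ K')
    (h : ∀ J : Arc, ∀ z ∈ J.box, ∀ ξ ∈ J.box, 1 / 4 * J.length ≤ 1 - ‖z‖ →
      1 / 4 * J.length ≤ 1 - ‖ξ‖ → w z ≤ K' * w ξ) (I : Arc) :
    ∀ᵐ z ∂volume, z ∈ I.pbox → ∃ l, z ∈ (I.sub l).pbox ∧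
      ENNReal.ofReal (w z) * volume (I.sub l).pbox ≤
        ENNReal.ofReal (4 * K') * weightMeasure w (I.sub l).pbox := by
  filter_upwards [I.ae_exists_sub] with z hz hzI
  obtain ⟨l, hl, ht⟩ := hz hzI
  refine ⟨l, hl, ?_⟩
  rw [volume_pbox, weightMeasure_pbox]
  exact ofReal_mul_volume_le_mass hK _ (h _) hl.1 ht

/-- If `k` is the first index where `p` fails, then `x / a ≤ C₀ * 2 ^ k` and the logarithm is at
most a multiple of `1 + k`. If `p` never fails, the right side is infinite. -/
theorem log_le_mul_one_add_tsum {C₀ : ℝ} (hC : 0 ≤ C₀) {x a : ℝ} (ha : 0 < a) (hx : 0 < x)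
    {p : ℕ → Prop} [DecidablePred p]
    (h : ∀ k : ℕ, ¬ p k → ENNReal.ofReal x ≤ ENNReal.ofReal C₀ * (2 ^ k * ENNReal.ofReal a)) :
    ENNReal.ofReal (Real.log (Real.exp 1 + x / a)) ≤
      ENNReal.ofReal (Real.log (Real.exp 1 + C₀)) * (1 + ∑' k, if p k then 1 else 0) := by
  have hL := one_le_log_exp_add hC
  by_cases hex : ∃ k, ¬ p k
  · have hk := Nat.find_spec hex
    set k := Nat.find hex
    have hlt : ∀ j < k, p j := fun j hj => not_not.1 (Nat.find_min hex hj)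
    have h1 := h k hk
    rw [show (2 : ℝ≥0∞) ^ k = ENNReal.ofReal (2 ^ k) by rw [ENNReal.ofReal_pow zero_le_two]; simp,
      ← ENNReal.ofReal_mul (by positivity), ← ENNReal.ofReal_mul hC,
      ENNReal.ofReal_le_ofReal_iff (by positivity), ← mul_assoc, ← div_le_iff₀ ha] at h1
    have hsum : ((k : ℕ) : ℝ≥0∞) ≤ ∑' k, if p k then (1 : ℝ≥0∞) else 0 := by
      refine le_trans (le_of_eq ?_) (ENNReal.sum_le_tsum (Finset.range k))
      rw [Finset.sum_congr rfl fun j hj => if_pos (hlt j (Finset.mem_range.1 hj))]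
      simp
    have hlog : Real.log (Real.exp 1 + x / a) ≤ Real.log (Real.exp 1 + C₀) * (1 + k) := by
      have h2 : (1 : ℝ) ≤ 2 ^ k := one_le_pow₀ one_le_two
      have h3 : Real.exp 1 + x / a ≤ (Real.exp 1 + C₀) * 2 ^ k := by
        nlinarith [Real.exp_pos 1]
      have h4 : Real.log ((Real.exp 1 + C₀) * 2 ^ k) =
          Real.log (Real.exp 1 + C₀) + k * Real.log 2 := by
        rw [Real.log_mul (by positivity) (by positivity), Real.log_pow]
      have h5 := Real.log_le_log (by positivity) h3
      have h6 : Real.log 2 ≤ 1 := by linarith [Real.log_two_lt_d9]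
      have h7 : (k : ℝ) * Real.log 2 ≤ k * Real.log (Real.exp 1 + C₀) :=
        mul_le_mul_of_nonneg_left (h6.trans hL) (Nat.cast_nonneg k)
      linarith
    calc _ ≤ ENNReal.ofReal (Real.log (Real.exp 1 + C₀) * (1 + k)) := ENNReal.ofReal_le_ofReal hlog
      _ = ENNReal.ofReal (Real.log (Real.exp 1 + C₀)) * (1 + (k : ℕ)) := by
        rw [ENNReal.ofReal_mul (by linarith), ENNReal.ofReal_add zero_le_one (Nat.cast_nonneg _),
          ENNReal.ofReal_one, ENNReal.ofReal_natCast]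
      _ ≤ _ := by gcongr
  · push Not at hex
    have : ∑' k, (if p k then (1 : ℝ≥0∞) else 0) = ⊤ := by
      simp only [hex, if_true]
      exact ENNReal.tsum_const_eq_top_of_ne_zero one_ne_zero
    rw [this, add_top, ENNReal.mul_top]
    · exact le_top
    · exact (ENNReal.ofReal_pos.2 (by linarith)).ne'

/-- By near constancy the logarithm is bounded by the number of dyadic stopping sets `E k`
containing the point, so its integral against `w` is at most a multiple of the mass plus the sum of
`w (E k)`. Each `w (E k)` is at most four times the level times the area, and summing levels over
the sets containing a point gives at most twice the maximal function. Thus `9 = 1 + 4 * 2`. -/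
theorem llogLBound_of_bInfty (hw : IsWeight w) {K' : ℝ} (hK : 0 ≤ K')
    (h : ∀ J : Arc, ∀ z ∈ J.box, ∀ ξ ∈ J.box, 1 / 4 * J.length ≤ 1 - ‖z‖ →
      1 / 4 * J.length ≤ 1 - ‖ξ‖ → w z ≤ K' * w ξ) (hB : BInfty w < ⊤) :
    LLogLBound w (9 * Real.log (Real.exp 1 + 4 * K') * (BInfty w).toReal) := by
  classical
  rw [llogLBound_iff]
  intro I
  have hA := boxAverage_pos hw I
  set a := boxAverage w I with ha
  set L : ℝ := Real.log (Real.exp 1 + 4 * K') with hL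
  have hL1 : 1 ≤ L := one_le_log_exp_add (by positivity)
  set B : List Bool → Set ℂ := fun l => (I.sub l).pbox with hBdef
  set ν := weightMeasure w with hν
  set E : ℕ → Set ℂ := fun k => superlevel B volume ν (2 ^ k * ENNReal.ofReal a) with hE
  have hBt : IsTree B := isTree_pbox I
  have hBm : ∀ l, MeasurableSet (B l) := fun l => (I.sub l).measurableSet_pbox
  have hEm : ∀ k, MeasurableSet (E k) := fun k => measurableSet_superlevel hBm
  have hEsub : ∀ k, E k ⊆ I.pbox := fun k => superlevel_subset hBt
  have hroot : ∀ k : ℕ, ν (B []) ≤ 2 ^ k * ENNReal.ofReal a * volume (B []) := by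
    intro k
    show weightMeasure w I.pbox ≤ _ * volume I.pbox
    rw [weightMeasure_pbox, volume_pbox, mul_assoc, ofReal_boxAverage_mul hw]
    exact le_mul_of_one_le_left zero_le (one_le_pow₀ one_le_two)
  have hEν : ∀ k, ν (E k) ≤ 4 * (2 ^ k * ENNReal.ofReal a) * volume (E k) := fun k =>
    measure_superlevel_le hBt hBm (fun b l => volume_pbox_le_four_mul_child I b l) (hroot k)
  have hmax : ∑' k, (2 ^ k * ENNReal.ofReal a) * volume (E k) ≤ 2 * (BInfty w * mass w I.box) := by
    refine le_trans ?_ (mul_le_mul' le_rfl (lintegral_maximal_le_bInfty hw I))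
    rw [← lintegral_const_mul' _ _ (by norm_num)]
    have h1 : ∀ k, (2 ^ k * ENNReal.ofReal a) * volume (E k) =
        ∫⁻ z in I.box, (2 ^ k * ENNReal.ofReal a) * (E k).indicator 1 z := fun k => by
      rw [lintegral_const_mul _ (measurable_one.indicator (hEm k)),
        lintegral_indicator_one (hEm k), Measure.restrict_apply (hEm k),
        inter_eq_left.2 ((hEsub k).trans sdiff_subset)]
    rw [tsum_congr h1, ← lintegral_tsum fun k =>
      ((measurable_one.indicator (hEm k)).const_mul _).aemeasurable]
    refine lintegral_mono fun z => ?_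
    have h2 : ∀ k, (2 ^ k * ENNReal.ofReal a) * (E k).indicator (1 : ℂ → ℝ≥0∞) z =
        if z ∈ E k then 2 ^ k * ENNReal.ofReal a else 0 := fun k => by
      rw [indicator_apply]; split_ifs <;> simp
    rw [tsum_congr h2]
    refine tsum_ite_le fun n hn => ?_
    refine (sum_range_two_pow_mul_le _ _).trans ?_
    rw [pow_succ', mul_assoc]
    exact mul_le_mul' le_rfl (lt_maximal_of_mem_superlevel I hn).le
  have hpt : ∀ᵐ z ∂(volume.restrict I.pbox),
      ENNReal.ofReal (w z * Real.log (Real.exp 1 + w z / a)) ≤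
      ENNReal.ofReal (w z) * (ENNReal.ofReal L * (1 + ∑' k, (E k).indicator 1 z)) := by
    rw [ae_restrict_iff' I.measurableSet_pbox]
    filter_upwards [ae_exists_mul_volume_le hK h I] with z hz hzI
    have hz0 := hw.1 z (I.pbox_subset_ball hzI)
    rw [ENNReal.ofReal_mul hz0.le]
    gcongr
    have h3 : ∀ k, (E k).indicator (1 : ℂ → ℝ≥0∞) z = if z ∈ E k then 1 else 0 := fun k => by
      rw [indicator_apply]; rfl
    rw [tsum_congr h3]
    refine log_le_mul_one_add_tsum (by positivity) hA hz0 fun k hk => ?_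
    exact le_mul_of_notMem_superlevel hBt
      (fun l => by show volume (I.sub l).pbox ≠ 0; rw [volume_pbox]
                   exact (I.sub l).volume_box_pos.ne')
      (fun l => by show volume (I.sub l).pbox ≠ ⊤; rw [volume_pbox]
                   exact (I.sub l).volume_box_ne_top) (hz hzI) hk
  have hB1 := one_le_bInfty hw
  calc ∫⁻ z in I.box, ENNReal.ofReal (w z * Real.log (Real.exp 1 + w z / a))
      = ∫⁻ z in I.pbox, ENNReal.ofReal (w z * Real.log (Real.exp 1 + w z / a)) := by
        rw [Measure.restrict_congr_set I.pbox_ae_eq]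
    _ ≤ ∫⁻ z in I.pbox, ENNReal.ofReal (w z) *
          (ENNReal.ofReal L * (1 + ∑' k, (E k).indicator 1 z)) := lintegral_mono_ae hpt
    _ = ∫⁻ z in I.pbox, (ENNReal.ofReal L * (1 + ∑' k, (E k).indicator 1 z)) ∂ν :=
        (hw.lintegral_weightMeasure I.pbox_subset_ball I.measurableSet_pbox _).symm
    _ = ENNReal.ofReal L * (mass w I.box + ∑' k, ν (E k)) := by
        have hm : ∀ k, Measurable ((E k).indicator (1 : ℂ → ℝ≥0∞)) := fun k =>
          measurable_one.indicator (hEm k)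
        rw [lintegral_const_mul' _ _ ENNReal.ofReal_ne_top, lintegral_add_left measurable_const,
          setLIntegral_one, lintegral_tsum fun k => (hm k).aemeasurable, hν, weightMeasure_pbox]
        congr 2
        refine tsum_congr fun k => ?_
        rw [lintegral_indicator_one (hEm k), Measure.restrict_apply (hEm k),
          inter_eq_left.2 (hEsub k)]
    _ ≤ ENNReal.ofReal L * (mass w I.box + 4 * (2 * (BInfty w * mass w I.box))) := by
        gcongr
        refine le_trans ?_ (mul_le_mul' le_rfl hmax)
        rw [← ENNReal.tsum_mul_left]
        refine ENNReal.tsum_le_tsum fun k => (hEν k).trans_eq (by ring)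
    _ ≤ ENNReal.ofReal L * (BInfty w * mass w I.box + 4 * (2 * (BInfty w * mass w I.box))) := by
        gcongr
        exact le_mul_of_one_le_left zero_le hB1
    _ = ENNReal.ofReal (9 * L * (BInfty w).toReal) * mass w I.box := by
        rw [ENNReal.ofReal_mul (by positivity), ENNReal.ofReal_mul (by norm_num),
          ENNReal.ofReal_toReal hB.ne]
        norm_num
        ring

/-! ### Smallness, reverse Hölder, and back to `L log L` -/

theorem smallOnSubsets_of_llogL (hw : IsWeight w) {C : ℝ} (hC : 0 < C) (h : LLogLBound w C) :
    SmallOnSubsets w := by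
  rw [llogLBound_iff] at h
  intro ε hε hε1
  -- Cut at `w = t * a`. Above the cut the logarithm is at least `Λ ≥ 3 * C / ε`, so that part costs
  -- at most `ε / 3`; below it, `δ = ε / (3 * t)` costs another `ε / 3`.
  set t := Real.exp (3 * C / ε) with ht
  have ht0 : 0 < t := Real.exp_pos _
  set Λ := Real.log (Real.exp 1 + t) with hΛ
  have hΛ0 : 0 < Λ := by linarith [one_le_log_exp_add ht0.le]
  have hΛ1 : C / Λ ≤ ε / 3 := by
    have : 3 * C / ε ≤ Λ := by
      rw [hΛ, Real.le_log_iff_exp_le (by positivity)]; linarith [Real.exp_pos 1]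
    rw [div_le_iff₀ hε] at this
    rw [div_le_iff₀ hΛ0]
    linarith
  refine ⟨ε / (3 * t), by positivity, fun I Ω _ hsub hv => ?_⟩
  have hA := boxAverage_pos hw I
  set a := boxAverage w I
  rw [ENNReal.div_lt_iff (Or.inl I.volume_box_pos.ne') (Or.inl I.volume_box_ne_top)] at hv
  have hpt : ∀ z, ENNReal.ofReal (w z) ≤ ENNReal.ofReal (t * a) +
      ENNReal.ofReal Λ⁻¹ * ENNReal.ofReal (w z * Real.log (Real.exp 1 + w z / a)) := by
    intro z
    by_cases hz : w z ≤ t * a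
    · exact (ENNReal.ofReal_le_ofReal hz).trans le_self_add
    · push Not at hz
      refine le_trans ?_ le_add_self
      rw [← ENNReal.ofReal_mul (by positivity)]
      apply ENNReal.ofReal_le_ofReal
      have hz0 : 0 < w z := lt_trans (by positivity) hz
      have : Λ ≤ Real.log (Real.exp 1 + w z / a) := by
        apply Real.log_le_log (by positivity)
        have : t ≤ w z / a := by rw [le_div_iff₀ hA]; exact hz.le
        linarith
      rw [inv_mul_eq_div, le_div_iff₀ hΛ0]
      gcongr
  have hm0 := hw.mass_pos I
  have hmt := hw.mass_ne_top I.box_subset_ball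
  calc mass w Ω ≤ ∫⁻ z in Ω, (ENNReal.ofReal (t * a) +
        ENNReal.ofReal Λ⁻¹ * ENNReal.ofReal (w z * Real.log (Real.exp 1 + w z / a))) :=
        lintegral_mono hpt
    _ = ENNReal.ofReal (t * a) * volume Ω + ENNReal.ofReal Λ⁻¹ *
        ∫⁻ z in Ω, ENNReal.ofReal (w z * Real.log (Real.exp 1 + w z / a)) := by
        rw [lintegral_add_left measurable_const, setLIntegral_const,
          lintegral_const_mul' _ _ ENNReal.ofReal_ne_top]
    _ ≤ ENNReal.ofReal (t * a) * (ENNReal.ofReal (ε / (3 * t)) * volume I.box) +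
        ENNReal.ofReal Λ⁻¹ * (ENNReal.ofReal C * mass w I.box) := by
        refine add_le_add (mul_le_mul' le_rfl hv.le) (mul_le_mul' le_rfl ?_)
        exact (lintegral_mono_set hsub).trans (h I)
    _ = ENNReal.ofReal (ε / 3 + C / Λ) * mass w I.box := by
        rw [← mul_assoc, ← mul_assoc, ← ENNReal.ofReal_mul (by positivity),
          ← ENNReal.ofReal_mul (by positivity), inv_mul_eq_div,
          show t * a * (ε / (3 * t)) = ε / 3 * a by field_simp, ENNReal.ofReal_mul (by positivity),
          mul_assoc, ofReal_boxAverage_mul hw, ← add_mul,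
          ENNReal.ofReal_add (by positivity) (by positivity)]
    _ < ENNReal.ofReal ε * mass w I.box := by
        refine ENNReal.mul_lt_mul_left hm0.ne' hmt ?_
        rw [ENNReal.ofReal_lt_ofReal_iff hε]
        linarith

theorem SmallOnSubsets.smallOnIntervalUnions (h : SmallOnSubsets w) : SmallOnIntervalUnions w := by
  intro ε hε hε1
  obtain ⟨δ, hδ, hs⟩ := h ε hε hε1
  refine ⟨δ, hδ, fun I E hE _ hsub hv => hs I _ ?_ ?_ hv⟩
  · exact (MeasurableSet.biUnion hE fun J _ => J.measurableSet_box).nullMeasurableSet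
  · exact iUnion₂_subset fun J hJ => Arc.box_subset_of_toSet_subset (hsub J hJ)

/-- The smallness condition for one pair of constants. -/
def SmallOnIntervalUnionsWith (w : ℂ → ℝ) (ε δ : ℝ) : Prop :=
  ∀ (I : Arc) (E : Set Arc), E.Countable → E.PairwiseDisjoint Arc.toSet →
    (∀ J ∈ E, J.toSet ⊆ I.toSet) →
    volume (⋃ J ∈ E, J.box) ≤ ENNReal.ofReal δ * volume I.box →
    mass w (⋃ J ∈ E, J.box) ≤ ENNReal.ofReal ε * mass w I.box

theorem SmallOnIntervalUnions.smallWith (h : SmallOnIntervalUnions w) :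
    ∃ ε δ : ℝ, 0 < ε ∧ ε < 1 ∧ 0 < δ ∧ SmallOnIntervalUnionsWith w ε δ := by
  obtain ⟨δ, hδ, hs⟩ := h (1 / 2) (by norm_num) (by norm_num)
  refine ⟨1 / 2, δ / 2, by norm_num, by norm_num, by positivity, fun I E hE hd hsub hv => ?_⟩
  refine (hs I E hE hd hsub ?_).le
  rw [ENNReal.div_lt_iff (Or.inl I.volume_box_pos.ne') (Or.inl I.volume_box_ne_top)]
  refine hv.trans_lt (ENNReal.mul_lt_mul_left I.volume_box_pos.ne' I.volume_box_ne_top ?_)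
  rw [ENNReal.ofReal_lt_ofReal_iff hδ]
  linarith

theorem Arc.sub_suffix_toSet_subset (I : Arc) {l m : List Bool} (h : l <:+ m) :
    (I.sub m).toSet ⊆ (I.sub l).toSet := (isTree_toSet I).subset_of_suffix h

/-- An antichain of nodes is a countable family of disjoint subarcs, so the hypothesis of the
stopping argument is an instance of smallness on unions; the puncture is null. -/
theorem SmallOnIntervalUnionsWith.tree {ε δ : ℝ} (h : SmallOnIntervalUnionsWith w ε δ) (I : Arc)
    (l : List Bool) (A : Set (List Bool)) (hA : IsAntichain (· <:+ ·) A) (hl : ∀ m ∈ A, l <:+ m)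
    (hv : volume (⋃ m ∈ A, (I.sub m).pbox) ≤ ENNReal.ofReal δ * volume (I.sub l).pbox) :
    weightMeasure w (⋃ m ∈ A, (I.sub m).pbox) ≤
      ENNReal.ofReal ε * weightMeasure w (I.sub l).pbox := by
  have hd : (I.sub '' A).PairwiseDisjoint Arc.toSet := by
    rintro _ ⟨m, hm, rfl⟩ _ ⟨m', hm', rfl⟩ hne
    exact (isTree_toSet I).pairwiseDisjoint hA hm hm' fun e => hne (by rw [e])
  have hsub : ⋃ m ∈ A, (I.sub m).pbox ⊆ ⋃ J ∈ I.sub '' A, J.box := by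
    rw [biUnion_image]
    exact iUnion₂_mono fun m _ => sdiff_subset
  have hsub' : ⋃ J ∈ I.sub '' A, J.box ⊆ (⋃ m ∈ A, (I.sub m).pbox) ∪ {0} := by
    rw [biUnion_image]
    refine iUnion₂_subset fun m hm z hz => ?_
    by_cases h0 : z = 0
    · exact Or.inr h0
    · exact Or.inl (mem_biUnion hm ⟨hz, h0⟩)
  have hv' : volume (⋃ J ∈ I.sub '' A, J.box) ≤ ENNReal.ofReal δ * volume (I.sub l).box := by
    rw [volume_pbox] at hv
    refine (measure_mono hsub').trans ((measure_union_le _ _).trans ?_)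
    rwa [measure_singleton, add_zero]
  rw [weightMeasure_apply w (iUnion₂_subset fun m _ => (I.sub m).pbox_subset_ball),
    weightMeasure_pbox]
  refine (lintegral_mono_set hsub).trans (h (I.sub l) _ (A.to_countable.image _) hd ?_ hv')
  rintro _ ⟨m, hm, rfl⟩
  exact I.sub_suffix_toSet_subset (hl m hm)

/-- The stopping lemma with `μ` the area, `ν = w dA` and `f = w`: integrating `w ^ s` against `w dA`
is integrating `w ^ (1 + s)`. -/
theorem SmallOnIntervalUnionsWith.reverseHolder (hw : IsWeight w) {K' : ℝ} (hK : 0 ≤ K')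
    (h : ∀ J : Arc, ∀ z ∈ J.box, ∀ ξ ∈ J.box, 1 / 4 * J.length ≤ 1 - ‖z‖ →
      1 / 4 * J.length ≤ 1 - ‖ξ‖ → w z ≤ K' * w ξ) {ε δ : ℝ} (hε1 : ε < 1)
    (hδ : 0 < δ) (hs : SmallOnIntervalUnionsWith w ε δ) : ReverseHolder w := by
  -- The 4 is the area ratio of a box to its child; the summand 1 secures `1 ≤ L`.
  set L : ℝ≥0∞ := 1 + 4 / ENNReal.ofReal δ with hL
  have hδ0 : ENNReal.ofReal δ ≠ 0 := (ENNReal.ofReal_pos.2 hδ).ne'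
  have hL1 : 1 ≤ L := le_self_add
  have hLt : L ≠ ⊤ := ENNReal.add_ne_top.2 ⟨by simp, ENNReal.div_ne_top (by norm_num) hδ0⟩
  have hLD : 4 ≤ ENNReal.ofReal δ * L := by
    rw [hL, mul_add, ENNReal.mul_div_cancel hδ0 ENNReal.ofReal_ne_top]
    exact le_add_self
  have hε : ENNReal.ofReal ε < 1 := ENNReal.ofReal_lt_one.2 hε1
  obtain ⟨s, hs0, hM⟩ := exists_rpow_tsum_lt_top hε hLt hL1
  set M : ℝ≥0∞ := 1 + ∑' k : ℕ, (L ^ s) ^ (k + 1) * ENNReal.ofReal ε ^ k with hMdef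
  have hMt : M ≠ ⊤ := ENNReal.add_ne_top.2 ⟨by simp, hM.ne⟩
  set P : ℝ≥0∞ := ENNReal.ofReal (4 * K') ^ s * M with hP
  have hPt : P ≠ ⊤ := ENNReal.mul_ne_top
    (ENNReal.rpow_ne_top_of_nonneg hs0.le ENNReal.ofReal_ne_top) hMt
  have hr : 0 < 1 + s := by linarith
  have hPr : P ^ (1 / (1 + s)) ≠ ⊤ := ENNReal.rpow_ne_top_of_nonneg (by positivity) hPt
  refine ⟨1 + s, (P ^ (1 / (1 + s))).toReal + 1, by linarith, by positivity, fun I => ?_⟩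
  have hA := boxAverage_pos hw I
  set a := ENNReal.ofReal (boxAverage w I) with ha
  have ha0 : a ≠ 0 := (ENNReal.ofReal_pos.2 hA).ne'
  have hat : a ≠ ⊤ := ENNReal.ofReal_ne_top
  have hmain := lintegral_rpow_le (μ := volume) (ν := weightMeasure w) (isTree_pbox I)
    (fun l => (I.sub l).measurableSet_pbox)
    (fun l => by rw [volume_pbox]; exact (I.sub l).volume_box_pos.ne')
    (fun l => by rw [volume_pbox]; exact (I.sub l).volume_box_ne_top)
    (by rw [weightMeasure_pbox]; exact hw.mass_ne_top (Arc.box_subset_ball _))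
    (fun b l => volume_pbox_le_four_mul_child I b l) (hs.tree I) hε hLD hL1 hLt ha0 hat
    (by
      show weightMeasure w I.pbox ≤ _ * volume I.pbox
      rw [weightMeasure_pbox, volume_pbox, ofReal_boxAverage_mul hw])
    (IsWeight.ae_weightMeasure w (ae_exists_mul_volume_le hK h I)) hs0.le
  change ∫⁻ z in I.pbox, ENNReal.ofReal (w z) ^ s ∂_ ≤
    (ENNReal.ofReal (4 * K') * a) ^ s * M * weightMeasure w I.pbox at hmain
  rw [hw.lintegral_weightMeasure I.pbox_subset_ball I.measurableSet_pbox, weightMeasure_pbox,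
    Measure.restrict_congr_set I.pbox_ae_eq, ← ofReal_boxAverage_mul hw] at hmain
  have hint : ∫⁻ z in I.box, ENNReal.ofReal (w z ^ (1 + s)) =
      ∫⁻ z in I.box, ENNReal.ofReal (w z) * ENNReal.ofReal (w z) ^ s := by
    refine setLIntegral_congr_fun I.measurableSet_box fun z hz => ?_
    have hz0 := hw.1 z (I.box_subset_ball hz)
    rw [Real.rpow_add hz0, Real.rpow_one, ENNReal.ofReal_mul hz0.le,
      ENNReal.ofReal_rpow_of_pos hz0]
  have havg : ⨍⁻ z in I.box, ENNReal.ofReal (w z ^ (1 + s)) ∂volume ≤ P * a ^ (1 + s) := by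
    rw [setLAverage_eq, hint]
    refine ENNReal.div_le_of_le_mul (hmain.trans_eq ?_)
    rw [ENNReal.mul_rpow_of_nonneg _ _ hs0.le, ENNReal.rpow_add _ _ ha0 hat, ENNReal.rpow_one, hP]
    ring
  rw [setLAverage_eq_boxAverage hw]
  calc _ ≤ (P * a ^ (1 + s)) ^ (1 / (1 + s)) := ENNReal.rpow_le_rpow havg (by positivity)
    _ = P ^ (1 / (1 + s)) * a := by
      rw [ENNReal.mul_rpow_of_nonneg _ _ (by positivity), ← ENNReal.rpow_mul,
        mul_one_div_cancel hr.ne', ENNReal.rpow_one]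
    _ ≤ _ := by
      gcongr
      rw [ENNReal.ofReal_add ENNReal.toReal_nonneg zero_le_one, ENNReal.ofReal_toReal hPr]
      exact le_self_add

theorem ReverseHolder.exists_llogLBound (hw : IsWeight w) (h : ReverseHolder w) :
    ∃ C : ℝ, 0 < C ∧ LLogLBound w C := by
  obtain ⟨r, C, hr, hC, h⟩ := h
  set s := r - 1 with hs
  have hs0 : 0 < s := by linarith
  refine ⟨2 + C ^ r / s, by positivity, llogLBound_iff.2 fun I => ?_⟩
  have hA := boxAverage_pos hw I
  have hI := h I
  rw [setLAverage_eq_boxAverage hw] at hI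
  set a := boxAverage w I with ha
  -- The logarithm grows more slowly than the power `s = r - 1`, so `w * log` is controlled by `w`
  -- and `w ^ r`.
  have hlog : ∀ x : ℝ, 0 < x → Real.log (Real.exp 1 + x) ≤ 2 + x ^ s / s := by
    intro x hx
    have he := Real.exp_one_lt_d9
    have h4 : Real.log 4 ≤ 2 := by
      rw [show (4 : ℝ) = 2 ^ 2 by norm_num, Real.log_pow]
      push_cast
      linarith [Real.log_two_lt_d9]
    rcases le_total x 1 with h1 | h1
    · have : Real.log (Real.exp 1 + x) ≤ Real.log 4 := Real.log_le_log (by positivity) (by linarith)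
      have : 0 ≤ x ^ s / s := by positivity
      linarith
    · have h2 : Real.log (Real.exp 1 + x) ≤ Real.log (4 * x) :=
        Real.log_le_log (by positivity) (by linarith)
      rw [Real.log_mul (by norm_num) hx.ne'] at h2
      have := Real.log_le_rpow_div hx.le hs0
      linarith
  have hpow : ∫⁻ z in I.box, ENNReal.ofReal (w z ^ r) ≤
      ENNReal.ofReal ((C * a) ^ r) * volume I.box := by
    have h1 : ⨍⁻ z in I.box, ENNReal.ofReal (w z ^ r) ∂volume ≤ ENNReal.ofReal ((C * a) ^ r) := by
      rw [← ENNReal.ofReal_rpow_of_pos (by positivity), ENNReal.ofReal_mul hC.le]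
      rwa [one_div, ENNReal.rpow_inv_le_iff (by linarith)] at hI
    rwa [setLAverage_eq, ENNReal.div_le_iff I.volume_box_pos.ne' I.volume_box_ne_top] at h1
  calc ∫⁻ z in I.box, ENNReal.ofReal (w z * Real.log (Real.exp 1 + w z / a))
      ≤ ∫⁻ z in I.box, (2 * ENNReal.ofReal (w z) +
          ENNReal.ofReal (a ^ (-s) / s) * ENNReal.ofReal (w z ^ r)) := by
        refine setLIntegral_mono' I.measurableSet_box fun z hz => ?_
        have hz0 := hw.1 z (I.box_subset_ball hz)
        rw [show (2 : ℝ≥0∞) = ENNReal.ofReal 2 by norm_num, ← ENNReal.ofReal_mul (by positivity),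
          ← ENNReal.ofReal_mul (by positivity), ← ENNReal.ofReal_add (by positivity) (by positivity)]
        apply ENNReal.ofReal_le_ofReal
        calc _ ≤ w z * (2 + (w z / a) ^ s / s) := by gcongr; exact hlog _ (by positivity)
          _ = 2 * w z + a ^ (-s) / s * w z ^ r := by
            rw [show r = 1 + s by rw [hs]; ring, Real.rpow_add hz0, Real.rpow_one,
              Real.div_rpow hz0.le hA.le, Real.rpow_neg hA.le]
            field_simp
    _ = 2 * mass w I.box +
          ENNReal.ofReal (a ^ (-s) / s) * ∫⁻ z in I.box, ENNReal.ofReal (w z ^ r) := by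
        rw [lintegral_add_left' ((hw.aemeasurable_restrict I.box_subset_ball).const_mul _),
          lintegral_const_mul' _ _ (by norm_num), lintegral_const_mul' _ _ ENNReal.ofReal_ne_top]
        rfl
    _ ≤ 2 * mass w I.box +
          ENNReal.ofReal (a ^ (-s) / s) * (ENNReal.ofReal ((C * a) ^ r) * volume I.box) := by
        gcongr
    _ = ENNReal.ofReal (2 + C ^ r / s) * mass w I.box := by
        have e : a ^ (-s) / s * (C * a) ^ r = C ^ r / s * a := by
          rw [show r = 1 + s by rw [hs]; ring, Real.mul_rpow hC.le hA.le, Real.rpow_add hA 1 s,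
            Real.rpow_one, Real.rpow_neg hA.le]
          field_simp
        rw [ENNReal.ofReal_add (by norm_num) (by positivity), add_mul, ← mul_assoc,
          ← ENNReal.ofReal_mul (by positivity), e, ENNReal.ofReal_mul (by positivity), mul_assoc,
          ofReal_boxAverage_mul hw]
        norm_num

/-! ### From smallness on subsets to `B_p` -/

/-- Under the smallness condition, sets of small relative mass miss a definite part of the area. -/
theorem SmallOnSubsets.exists_volume_le (h : SmallOnSubsets w) (hw : IsWeight w) :
    ∃ ε : ℝ≥0∞, ε < 1 ∧ ∀ (I : Arc) (Ω : Set ℂ), MeasurableSet Ω → Ω ⊆ I.box →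
      mass w Ω ≤ 4⁻¹ * mass w I.box → volume Ω ≤ ε * volume I.box := by
  obtain ⟨δ, hδ, hs⟩ := h (1 / 2) (by norm_num) (by norm_num)
  refine ⟨1 - ENNReal.ofReal δ, ENNReal.sub_lt_self (by simp) one_ne_zero
    (ENNReal.ofReal_pos.2 hδ).ne', fun I Ω hΩ hsub hm => ?_⟩
  have hm0 := hw.mass_pos I
  have hmt := hw.mass_ne_top I.box_subset_ball
  have hsum : mass w I.box = mass w Ω + mass w (I.box \ Ω) := by
    rw [mass, ← lintegral_inter_add_sdiff _ _ hΩ, inter_eq_right.2 hsub]; rfl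
  have hvsum : volume I.box = volume Ω + volume (I.box \ Ω) := by
    rw [← measure_inter_add_sdiff I.box hΩ, inter_eq_right.2 hsub]
  -- Otherwise the complement would carry less than half of the mass and `Ω` at most a quarter.
  have hbig : ENNReal.ofReal δ * volume I.box ≤ volume (I.box \ Ω) := by
    by_contra hlt
    push Not at hlt
    have h1 := hs I (I.box \ Ω) (I.measurableSet_box.diff hΩ).nullMeasurableSet sdiff_subset
      ((ENNReal.div_lt_iff (Or.inl I.volume_box_pos.ne') (Or.inl I.volume_box_ne_top)).2 hlt)
    have h2 : mass w I.box < 4⁻¹ * mass w I.box + ENNReal.ofReal (1 / 2) * mass w I.box := by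
      calc mass w I.box = mass w Ω + mass w (I.box \ Ω) := hsum
        _ < _ := ENNReal.add_lt_add_of_le_of_lt
          (hw.mass_ne_top (hsub.trans I.box_subset_ball)) hm h1
    rw [← add_mul] at h2
    have h3 : (4⁻¹ + ENNReal.ofReal (1 / 2) : ℝ≥0∞) ≤ 1 := by
      rw [show (4⁻¹ : ℝ≥0∞) = ENNReal.ofReal (1 / 4) by
        rw [one_div, ENNReal.ofReal_inv_of_pos (by norm_num)]; norm_num,
        ← ENNReal.ofReal_add (by norm_num) (by norm_num)]
      exact ENNReal.ofReal_le_one.2 (by norm_num)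
    exact absurd h2 (not_lt.2 (mul_le_of_le_one_left zero_le h3))
  have hfin : volume (I.box \ Ω) ≠ ⊤ :=
    ne_top_of_le_ne_top I.volume_box_ne_top (measure_mono sdiff_subset)
  calc volume Ω = volume I.box - volume (I.box \ Ω) := by
        rw [hvsum, ENNReal.add_sub_cancel_right hfin]
    _ ≤ volume I.box - ENNReal.ofReal δ * volume I.box := tsub_le_tsub_left hbig _
    _ = (1 - ENNReal.ofReal δ) * volume I.box := by
        rw [ENNReal.sub_mul fun _ _ => I.volume_box_ne_top, one_mul]

/-- The stopping lemma with the measures exchanged: `μ = w dA`, `ν` the area and `f = 1 / w`.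
Doubling and the pointwise bound now concern `w dA`, which is why mass away from the circle is
needed. -/
theorem SmallOnSubsets.exists_bp_lt_top (h : SmallOnSubsets w) (hw : IsWeight w) {ρ K : ℝ}
    (h0 : 0 < ρ) (h1 : ρ < 1) (hN : NearlyConstantOnTops ρ K w) :
    ∃ p : ℝ, 1 < p ∧ Bp p w < ⊤ := by
  obtain ⟨κ, hκ0, hκ1, hκ⟩ := h.exists_mass_le hw
  obtain ⟨K', hK, hK'⟩ := exists_nearlyConstant h0 h1 K hκ0
  obtain ⟨ε, hε, hsmall⟩ := h.exists_volume_le hw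
  have htop : ∀ (J : Arc), ∀ z ∈ J.box, κ * J.length ≤ 1 - ‖z‖ →
      mass w J.box ≤ ENNReal.ofReal (2 * K') * ENNReal.ofReal (w z) * volume J.box :=
    fun J z hz ht => mass_le_mul_ofReal_mul_volume hK.le J (hK' w hw hN J) (hκ J) hz ht
  set C := ENNReal.ofReal (2 * K') with hC
  have hCt : C ≠ ⊤ := ENNReal.ofReal_ne_top
  set L : ℝ≥0∞ := 1 + 4 * (C * 16) with hL
  have hL1 : 1 ≤ L := le_self_add
  have hLt : L ≠ ⊤ := ENNReal.add_ne_top.2 ⟨by simp, by finiteness⟩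
  have hLD : C * 16 ≤ 4⁻¹ * L := by
    rw [hL, mul_add, ← mul_assoc 4⁻¹ 4, ENNReal.inv_mul_cancel (by norm_num) (by norm_num), one_mul]
    exact le_add_self
  obtain ⟨s, hs0, hM⟩ := exists_rpow_tsum_lt_top hε hLt hL1
  set M : ℝ≥0∞ := 1 + ∑' k : ℕ, (L ^ s) ^ (k + 1) * ε ^ k with hMdef
  have hMt : M ≠ ⊤ := ENNReal.add_ne_top.2 ⟨by simp, hM.ne⟩
  -- This `p` makes `1 - p'` equal to `-s` and `p - 1` equal to `1 / s`.
  refine ⟨1 + 1 / s, by linarith [one_div_pos.2 hs0], ?_⟩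
  refine lt_of_le_of_lt (iSup_le fun I => ?_) (show C * M ^ (1 / s) < ⊤ from
    ENNReal.mul_lt_top hCt.lt_top (ENNReal.rpow_lt_top_of_nonneg (by positivity) hMt))
  have hA := boxAverage_pos hw I
  set a := ENNReal.ofReal (boxAverage w I) with ha
  have ha0 : a ≠ 0 := (ENNReal.ofReal_pos.2 hA).ne'
  have hat : a ≠ ⊤ := ENNReal.ofReal_ne_top
  have hsub_ball : ∀ A : Set (List Bool), ⋃ m ∈ A, (I.sub m).pbox ⊆ Metric.ball 0 1 := fun A =>
    iUnion₂_subset fun m _ => (I.sub m).pbox_subset_ball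
  have hmain := lintegral_rpow_le (μ := weightMeasure w) (ν := volume) (isTree_pbox I)
    (D := C * 16) (δ := 4⁻¹) (ε := ε) (L := L) (C := C) (a := a⁻¹)
    (f := fun z => (ENNReal.ofReal (w z))⁻¹)
    (fun l => (I.sub l).measurableSet_pbox)
    (fun l => by rw [weightMeasure_pbox]; exact (hw.mass_pos _).ne')
    (fun l => by rw [weightMeasure_pbox]; exact hw.mass_ne_top (Arc.box_subset_ball _))
    (by rw [volume_pbox]; exact Arc.volume_box_ne_top _)
    (fun b l => by
      rw [weightMeasure_pbox, weightMeasure_pbox]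
      exact mass_le_mul_mass_child hκ0 hκ1 _ (htop _) b)
    (fun l A hA hl hv => by
      rw [weightMeasure_apply w (hsub_ball A), weightMeasure_pbox] at hv
      rw [volume_pbox]
      refine hsmall (I.sub l) _ (MeasurableSet.biUnion A.to_countable
        fun m _ => (I.sub m).measurableSet_pbox) ?_ hv
      exact iUnion₂_subset fun m hm => sdiff_subset.trans
        (Arc.box_subset_of_toSet_subset (I.sub_suffix_toSet_subset (hl m hm))))
    hε hLD hL1 hLt (ENNReal.inv_ne_zero.2 hat) (ENNReal.inv_ne_top.2 ha0)
    (by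
      show volume I.pbox ≤ _ * weightMeasure w I.pbox
      rw [weightMeasure_pbox, volume_pbox, ← ofReal_boxAverage_mul hw, ← mul_assoc,
        ENNReal.inv_mul_cancel ha0 hat, one_mul])
    (by
      filter_upwards [I.ae_exists_sub] with z hz hzI
      obtain ⟨l, hl, ht⟩ := hz hzI
      refine ⟨l, hl, ?_⟩
      have hz0 := hw.1 z (I.pbox_subset_ball hzI)
      have hlp := (I.sub l).length_pos
      rw [weightMeasure_pbox, volume_pbox]
      calc (ENNReal.ofReal (w z))⁻¹ * mass w (I.sub l).box
          ≤ (ENNReal.ofReal (w z))⁻¹ * (C * ENNReal.ofReal (w z) * volume (I.sub l).box) := by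
            gcongr
            exact htop _ z hl.1 (by nlinarith)
        _ = ((ENNReal.ofReal (w z))⁻¹ * ENNReal.ofReal (w z)) * (C * volume (I.sub l).box) := by
            ring
        _ = C * volume (I.sub l).box := by
            rw [ENNReal.inv_mul_cancel (ENNReal.ofReal_pos.2 hz0).ne' ENNReal.ofReal_ne_top,
              one_mul])
    hs0.le
  change ∫⁻ z in I.pbox, (ENNReal.ofReal (w z))⁻¹ ^ s ≤ (C * a⁻¹) ^ s * M * volume I.pbox at hmain
  rw [volume_pbox, Measure.restrict_congr_set I.pbox_ae_eq] at hmain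
  have hexp : 1 - (1 + 1 / s) / (1 + 1 / s - 1) = -s := by field_simp; ring
  have hint : ∫⁻ z in I.box, ENNReal.ofReal (w z ^ (-s)) =
      ∫⁻ z in I.box, (ENNReal.ofReal (w z))⁻¹ ^ s := by
    refine setLIntegral_congr_fun I.measurableSet_box fun z hz => ?_
    have hz0 := hw.1 z (I.box_subset_ball hz)
    rw [ENNReal.inv_rpow, ← ENNReal.rpow_neg, ENNReal.ofReal_rpow_of_pos hz0]
  have havg : ⨍⁻ z in I.box, ENNReal.ofReal (w z ^ (-s)) ∂volume ≤ (C * a⁻¹) ^ s * M := by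
    rw [setLAverage_eq, hint]
    exact ENNReal.div_le_of_le_mul hmain
  rw [hexp, setLAverage_eq_boxAverage hw, show 1 + 1 / s - 1 = 1 / s by ring]
  calc a * (⨍⁻ z in I.box, ENNReal.ofReal (w z ^ (-s)) ∂volume) ^ (1 / s)
      ≤ a * ((C * a⁻¹) ^ s * M) ^ (1 / s) := by gcongr
    _ = a * (C * a⁻¹ * M ^ (1 / s)) := by
        rw [ENNReal.mul_rpow_of_nonneg _ _ (by positivity), ← ENNReal.rpow_mul,
          mul_one_div_cancel hs0.ne', ENNReal.rpow_one]
    _ = (a * a⁻¹) * (C * M ^ (1 / s)) := by ring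
    _ = C * M ^ (1 / s) := by rw [ENNReal.mul_inv_cancel ha0 hat, one_mul]

/-! ### From `B_p` to the exponential condition -/

theorem IsWeight.integrableOn_box (hw : IsWeight w) (I : Arc) : IntegrableOn w I.box volume :=
  hw.2.mono_set I.box_subset_ball

theorem average_eq_boxAverage (hw : IsWeight w) (I : Arc) :
    ⨍ z in I.box, w z = boxAverage w I := by
  rw [setAverage_eq, boxAverage, integral_eq_lintegral_of_nonneg_ae, smul_eq_mul, inv_mul_eq_div]
  · rfl
  · filter_upwards [ae_restrict_mem I.measurableSet_box] with z hz
    exact (hw.1 z (I.box_subset_ball hz)).le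
  · exact (hw.integrableOn_box I).aestronglyMeasurable

theorem expCondition_of_bp (hw : IsWeight w) {p : ℝ} (hp : 1 < p) (hB : Bp p w < ⊤) :
    ExpCondition w := by
  set s := (p - 1)⁻¹ with hs
  have hp0 : 0 < p - 1 := by linarith
  have hs0 : 0 < s := inv_pos.2 hp0
  have hexp : 1 - p / (p - 1) = -s := by rw [hs]; field_simp; ring
  refine ⟨(Bp p w).toReal + 1, by positivity, fun I => ?_⟩
  have hA := boxAverage_pos hw I
  have ha0 := (ENNReal.ofReal_pos.2 hA).ne'
  have hBI : ENNReal.ofReal (boxAverage w I) *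
      (⨍⁻ z in I.box, ENNReal.ofReal (w z ^ (-s)) ∂volume) ^ (p - 1) ≤ Bp p w := by
    rw [← setLAverage_eq_boxAverage hw, ← hexp]
    exact le_iSup (fun I : Arc => (⨍⁻ z in I.box, ENNReal.ofReal (w z) ∂volume) *
      (⨍⁻ z in I.box, ENNReal.ofReal (w z ^ (1 - p / (p - 1))) ∂volume) ^ (p - 1)) I
  set X := ⨍⁻ z in I.box, ENNReal.ofReal (w z ^ (-s)) ∂volume with hX
  have hXt : X ≠ ⊤ := by
    intro hXt
    rw [hXt, ENNReal.top_rpow_of_pos hp0, ENNReal.mul_top ha0] at hBI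
    exact absurd hBI (not_le.2 hB)
  have hpos : ∀ᵐ z ∂(volume.restrict I.box), 0 < w z := by
    filter_upwards [ae_restrict_mem I.measurableSet_box] with z hz
    exact hw.1 z (I.box_subset_ball hz)
  have hwI := hw.integrableOn_box I
  have hmeas : AEMeasurable w (volume.restrict I.box) := hwI.aestronglyMeasurable.aemeasurable
  have hvi : IntegrableOn (fun z => w z ^ (-s)) I.box volume := by
    refine ⟨(hmeas.pow_const _).aestronglyMeasurable, ?_⟩
    rw [hasFiniteIntegral_iff_ofReal (by filter_upwards [hpos] with z hz using by positivity)]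
    rw [setLAverage_eq] at hX
    by_contra hcon
    rw [not_lt, top_le_iff] at hcon
    rw [hcon, ENNReal.top_div_of_ne_top I.volume_box_ne_top] at hX
    exact hXt hX
  -- The logarithm is dominated by `w` on one side and by `w ^ (-s) / s` on the other.
  have hlog : IntegrableOn (fun z => Real.log (w z)⁻¹) I.box volume := by
    refine Integrable.mono' (hwI.add (hvi.div_const s))
      (hmeas.inv.log).aestronglyMeasurable ?_
    filter_upwards [hpos] with z hz
    have h1 := Real.log_le_self hz.le
    have h2 := Real.log_le_rpow_div (inv_pos.2 hz).le hs0
    rw [Real.inv_rpow hz.le, ← Real.rpow_neg hz.le] at h2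
    have h3 : 0 < w z ^ (-s) / s := by positivity
    rw [Real.norm_eq_abs, abs_le, Pi.add_apply]
    rw [Real.log_inv] at *
    constructor <;> linarith
  refine ⟨hlog, ?_⟩
  rw [average_eq_boxAverage hw]
  set b := ⨍ z in I.box, Real.log (w z)⁻¹ with hb
  have hcomp : ∀ᵐ z ∂(volume.restrict I.box),
      w z ^ (-s) = Real.exp (s * Real.log (w z)⁻¹) := by
    filter_upwards [hpos] with z hz
    rw [Real.rpow_def_of_pos hz, Real.log_inv]
    ring_nf
  -- Jensen for the exponential applied to `s * log (1 / w)`.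
  have hJ : Real.exp (s * b) ≤ X.toReal := by
    have h1 := convexOn_exp.map_set_average_le (μ := volume) (t := I.box)
      (f := fun z => s * Real.log (w z)⁻¹) Real.continuous_exp.continuousOn isClosed_univ
      I.volume_box_pos.ne' I.volume_box_ne_top (Filter.Eventually.of_forall fun _ => mem_univ _)
      (hlog.const_mul s) (hvi.congr hcomp)
    have h2 : ⨍ z in I.box, s * Real.log (w z)⁻¹ = s * b := by
      rw [hb, setAverage_eq, setAverage_eq, integral_const_mul, smul_eq_mul, smul_eq_mul]
      ring
    have h3 : ⨍ z in I.box, Real.exp (s * Real.log (w z)⁻¹) = X.toReal := by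
      rw [hX, setLAverage_eq, setAverage_eq, ← integral_congr_ae hcomp,
        integral_eq_lintegral_of_nonneg_ae
          (by filter_upwards [hpos] with z hz using by positivity) hvi.aestronglyMeasurable,
        ENNReal.toReal_div, smul_eq_mul, inv_mul_eq_div]
      rfl
    rwa [h2, h3] at h1
  have hE : Real.exp b ≤ X.toReal ^ (p - 1) := by
    calc Real.exp b = Real.exp (s * b) ^ (p - 1) := by
          rw [← Real.exp_mul, hs]
          congr 1
          field_simp
      _ ≤ _ := Real.rpow_le_rpow (Real.exp_pos _).le hJ hp0.le
  have hfin := ENNReal.toReal_mono hB.ne hBI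
  rw [ENNReal.toReal_mul, ENNReal.toReal_ofReal hA.le, ← ENNReal.toReal_rpow] at hfin
  calc boxAverage w I * Real.exp b ≤ boxAverage w I * X.toReal ^ (p - 1) := by gcongr
    _ ≤ (Bp p w).toReal + 1 := by linarith

/-! ### From the exponential condition to smallness on unions -/

/-- The exponential condition bounds the area on which `w` is much smaller than its average. -/
theorem ExpCondition.exists_volume_le (hw : IsWeight w) (h : ExpCondition w) :
    ∃ γ : ℝ, 0 < γ ∧ γ ≤ 1 ∧ ∀ I : Arc,
      (volume.restrict I.box) {z | w z ≤ γ * boxAverage w I} ≤ 4⁻¹ * volume I.box := by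
  obtain ⟨C, hC, h⟩ := h
  refine ⟨min 1 (Real.exp (-(4 * C)) / C), by positivity, min_le_left _ _, fun I => ?_⟩
  obtain ⟨hlog, hle⟩ := h I
  rw [average_eq_boxAverage hw] at hle
  have hA := boxAverage_pos hw I
  set γ := min 1 (Real.exp (-(4 * C)) / C) with hγ
  have hγC : γ * C ≤ Real.exp (-(4 * C)) := by
    rw [← le_div_iff₀ hC]; exact min_le_right _ _
  have hγ0 : 0 < γ := by positivity
  set b := ⨍ z in I.box, Real.log (w z)⁻¹ with hb
  set V := (volume I.box).toReal with hV
  have hV0 : 0 < V := ENNReal.toReal_pos I.volume_box_pos.ne' I.volume_box_ne_top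
  have hwI := hw.integrableOn_box I
  -- With `u = exp b * w` this is `u - log u`, which is nonnegative. Its integral is at most `C * V`
  -- because the logarithm averages to `b`. Where `w ≤ γ * a` one has `u ≤ exp (-4 * C)`, hence `g ≥
  -- 4 * C`, and Markov's inequality gives the quarter.
  set g : ℂ → ℝ := fun z => Real.exp b * w z + (Real.log (w z)⁻¹ - b) with hg
  have hcst : IntegrableOn (fun _ : ℂ => b) I.box volume :=
    integrableOn_const I.volume_box_ne_top
  have hgI : IntegrableOn g I.box volume := (hwI.const_mul _).add (hlog.sub hcst)
  have hglow : ∀ z, 0 < w z → -Real.log (Real.exp b * w z) + Real.exp b * w z = g z := by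
    intro z hz
    rw [Real.log_mul (Real.exp_pos _).ne' hz.ne', Real.log_exp, hg]
    simp only [Real.log_inv]
    ring
  have hgint : ∫ z in I.box, g z ≤ C * V := by
    have h1 : ∫ z in I.box, w z = boxAverage w I * V := by
      rw [← average_eq_boxAverage hw, setAverage_eq, smul_eq_mul, measureReal_def, ← hV,
        mul_comm, mul_inv_cancel_left₀ hV0.ne']
    have h2 : ∫ z in I.box, Real.log (w z)⁻¹ = b * V := by
      rw [hb, setAverage_eq, smul_eq_mul, measureReal_def, ← hV, mul_comm,
        mul_inv_cancel_left₀ hV0.ne']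
    have h3 : ∫ z in I.box, g z = Real.exp b * (boxAverage w I * V) + (b * V - b * V) := by
      have h4 : ∫ z in I.box, g z = (∫ z in I.box, Real.exp b * w z) +
          ∫ z in I.box, (Real.log (w z)⁻¹ - b) := integral_add (hwI.const_mul _) (hlog.sub hcst)
      rw [h4, integral_const_mul, integral_sub hlog hcst, h1, h2, setIntegral_const, smul_eq_mul, measureReal_def,
        mul_comm V b]
    rw [h3]
    calc _ = (boxAverage w I * Real.exp b) * V := by ring
      _ ≤ C * V := by gcongr
  have hnn : 0 ≤ᵐ[volume.restrict I.box] g := by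
    filter_upwards [ae_restrict_mem I.measurableSet_box] with z hz
    have hz0 := hw.1 z (I.box_subset_ball hz)
    rw [Pi.zero_apply, ← hglow z hz0]
    linarith [Real.log_le_self (mul_pos (Real.exp_pos b) hz0).le]
  have hmk := mul_meas_ge_le_integral_of_nonneg hnn hgI (4 * C)
  have hsub : (volume.restrict I.box) {z | w z ≤ γ * boxAverage w I} ≤
      (volume.restrict I.box) {z | 4 * C ≤ g z} := by
    refine measure_mono_ae ?_
    filter_upwards [ae_restrict_mem I.measurableSet_box] with z hz
    intro hzw
    have hzw' : w z ≤ γ * boxAverage w I := hzw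
    have hz0 := hw.1 z (I.box_subset_ball hz)
    show 4 * C ≤ g z
    rw [← hglow z hz0]
    have h1 : Real.exp b * w z ≤ Real.exp (-(4 * C)) :=
      calc Real.exp b * w z ≤ Real.exp b * (γ * boxAverage w I) := by gcongr
        _ = γ * (boxAverage w I * Real.exp b) := by ring
        _ ≤ γ * C := by gcongr
        _ ≤ _ := hγC
    have h2 := Real.log_le_log (by positivity) h1
    rw [Real.log_exp] at h2
    have h3 : 0 < Real.exp b * w z := by positivity
    linarith
  refine hsub.trans ?_
  have hfin : (volume.restrict I.box) {z | 4 * C ≤ g z} ≠ ⊤ :=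
    ne_top_of_le_ne_top I.volume_box_ne_top
      ((measure_mono (subset_univ _)).trans_eq (Measure.restrict_apply_univ _))
  have h4 : (volume.restrict I.box).real {z | 4 * C ≤ g z} ≤ 1 / 4 * V := by
    have := hmk.trans hgint
    nlinarith
  rw [measureReal_def] at h4
  rw [← ENNReal.ofReal_toReal hfin, ← ENNReal.ofReal_toReal I.volume_box_ne_top,
    show (4⁻¹ : ℝ≥0∞) = ENNReal.ofReal (1 / 4) by
        rw [one_div, ENNReal.ofReal_inv_of_pos (by norm_num)]; norm_num,
    ← ENNReal.ofReal_mul (by norm_num)]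
  exact ENNReal.ofReal_le_ofReal h4

/-- If the union takes at most a quarter of the area and `w` is below `γ` times its average on at
most another quarter, then half of the box lies outside both. It carries at least the fraction `γ /
2` of the mass. -/
theorem ExpCondition.smallWith (hw : IsWeight w) (h : ExpCondition w) :
    ∃ ε δ : ℝ, 0 < ε ∧ ε < 1 ∧ 0 < δ ∧ SmallOnIntervalUnionsWith w ε δ := by
  obtain ⟨γ, hγ0, hγ1, hγ⟩ := h.exists_volume_le hw
  refine ⟨1 - γ / 2, 1 / 4, by linarith, by linarith, by norm_num, fun I E hE _ hsub hv => ?_⟩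
  have hA := boxAverage_pos hw I
  set a := boxAverage w I with ha
  set Ω := ⋃ J ∈ E, J.box with hΩ
  have hΩm : MeasurableSet Ω := MeasurableSet.biUnion hE fun J _ => J.measurableSet_box
  have hΩs : Ω ⊆ I.box := iUnion₂_subset fun J hJ => Arc.box_subset_of_toSet_subset (hsub J hJ)
  set R := I.box \ Ω with hR
  have hRs : R ⊆ I.box := sdiff_subset
  have hvR : volume I.box ≤ volume Ω + volume R := by
    rw [← measure_inter_add_sdiff I.box hΩm, inter_eq_right.2 hΩs]
  have hmR : mass w I.box = mass w Ω + mass w R := by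
    rw [mass, ← lintegral_inter_add_sdiff _ _ hΩm, inter_eq_right.2 hΩs]; rfl
  set S := {z | ENNReal.ofReal (γ * a) ≤ ENNReal.ofReal (w z)} with hS
  have hmk : ENNReal.ofReal (γ * a) * (volume.restrict R) S ≤ mass w R :=
    mul_meas_ge_le_lintegral₀ (hw.aemeasurable_restrict (hRs.trans I.box_subset_ball)) _
  have hSc : (volume.restrict R) Sᶜ ≤ 4⁻¹ * volume I.box := by
    refine le_trans ?_ (hγ I)
    refine (measure_mono fun z hz => ?_).trans (Measure.restrict_mono hRs le_rfl _)
    have hz' : ¬ (ENNReal.ofReal (γ * a) ≤ ENNReal.ofReal (w z)) := hz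
    by_contra hcon
    have hcon' : ¬ (w z ≤ γ * a) := hcon
    push Not at hcon'
    exact hz' (ENNReal.ofReal_le_ofReal hcon'.le)
  -- Subadditivity suffices here, so `S` need not be measurable.
  have hRS : volume R ≤ (volume.restrict R) S + (volume.restrict R) Sᶜ := by
    rw [← Measure.restrict_apply_univ (μ := volume) R]
    exact measure_univ_le_add_compl S
  have hVt := I.volume_box_ne_top
  have hmt := hw.mass_ne_top I.box_subset_ball
  have hmass := ofReal_boxAverage_mul hw I
  rw [show ENNReal.ofReal (1 / 4) = 4⁻¹ by
        rw [one_div, ENNReal.ofReal_inv_of_pos (by norm_num)]; norm_num] at hv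
  have hhalf : 2⁻¹ * volume I.box ≤ (volume.restrict R) S := by
    have h1 : volume I.box ≤ 2⁻¹ * volume I.box + (volume.restrict R) S :=
      calc volume I.box ≤ 4⁻¹ * volume I.box +
            ((volume.restrict R) S + 4⁻¹ * volume I.box) :=
            hvR.trans (add_le_add hv (hRS.trans (add_le_add le_rfl hSc)))
        _ = (4⁻¹ + 4⁻¹) * volume I.box + (volume.restrict R) S := by ring
        _ = _ := by
          congr 2
          rw [← two_mul, show (4 : ℝ≥0∞) = 2 * 2 by norm_num,
            ENNReal.mul_inv (by simp) (by simp), ← mul_assoc,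
            ENNReal.mul_inv_cancel (by simp) (by simp), one_mul]
    have h2 : volume I.box = 2⁻¹ * volume I.box + 2⁻¹ * volume I.box := by
      rw [← add_mul, ENNReal.inv_two_add_inv_two, one_mul]
    nth_rewrite 1 [h2] at h1
    exact (ENNReal.add_le_add_iff_left (ENNReal.mul_ne_top (by simp) hVt)).1 h1
  have hlow : ENNReal.ofReal (γ / 2) * mass w I.box ≤ mass w R :=
    calc ENNReal.ofReal (γ / 2) * mass w I.box
        = ENNReal.ofReal (γ * a) * (2⁻¹ * volume I.box) := by
          rw [← hmass, ENNReal.ofReal_mul hγ0.le, div_eq_mul_inv, ENNReal.ofReal_mul hγ0.le,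
            ENNReal.ofReal_inv_of_pos two_pos, ENNReal.ofReal_ofNat]
          ring
      _ ≤ _ := mul_le_mul' le_rfl hhalf
      _ ≤ _ := hmk
  have hRt : ENNReal.ofReal (γ / 2) * mass w I.box ≠ ⊤ := ENNReal.mul_ne_top (by simp) hmt
  refine (ENNReal.add_le_add_iff_right hRt).1 ?_
  calc mass w Ω + ENNReal.ofReal (γ / 2) * mass w I.box ≤ mass w Ω + mass w R :=
        add_le_add le_rfl hlow
    _ = ENNReal.ofReal (1 - γ / 2) * mass w I.box + ENNReal.ofReal (γ / 2) * mass w I.box := by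
        rw [← hmR, ← add_mul, ← ENNReal.ofReal_add (by linarith) (by linarith)]
        simp

end Bekolle

/-! ### Assembly of the equivalences -/

theorem theorem1 :
    (∀ w : ℂ → ℝ, Bekolle.IsWeight w →
      (∃ ρ K : ℝ, 0 < ρ ∧ ρ < 1 ∧ Bekolle.NearlyConstantOnTops ρ K w) →
      List.TFAE
        [ Bekolle.BInfty w < ⊤,
          ∃ C : ℝ, 0 < C ∧ Bekolle.LLogLBound w C,
          Bekolle.SmallOnIntervalUnions w,
          Bekolle.SmallOnSubsets w,
          Bekolle.ReverseHolder w,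
          ∃ p : ℝ, 1 < p ∧ Bekolle.Bp p w < ⊤,
          Bekolle.ExpCondition w ]) ∧
    (∀ ρ K : ℝ, 0 < ρ → ρ < 1 → ∃ C' : ℝ, 0 < C' ∧
      ∀ w : ℂ → ℝ, Bekolle.IsWeight w → Bekolle.NearlyConstantOnTops ρ K w →
        Bekolle.BInfty w < ⊤ → Bekolle.LLogLBound w (C' * (Bekolle.BInfty w).toReal)) := by
  have hquant : ∀ ρ K : ℝ, 0 < ρ → ρ < 1 → ∃ C' : ℝ, 0 < C' ∧
      ∀ w : ℂ → ℝ, Bekolle.IsWeight w → Bekolle.NearlyConstantOnTops ρ K w →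
        Bekolle.BInfty w < ⊤ → Bekolle.LLogLBound w (C' * (Bekolle.BInfty w).toReal) := by
    intro ρ K h0 h1
    obtain ⟨K', hK, hK'⟩ := Bekolle.exists_nearlyConstant h0 h1 K (by norm_num : (0 : ℝ) < 1 / 4)
    have := Bekolle.one_le_log_exp_add (by positivity : 0 ≤ 4 * K')
    exact ⟨9 * Real.log (Real.exp 1 + 4 * K'), by linarith, fun w hw hN hB =>
      Bekolle.llogLBound_of_bInfty hw hK.le (hK' w hw hN) hB⟩
  refine ⟨fun w hw ⟨ρ, K, h0, h1, hN⟩ => ?_, hquant⟩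
  obtain ⟨K', hK, hK'⟩ := Bekolle.exists_nearlyConstant h0 h1 K (by norm_num : (0 : ℝ) < 1 / 4)
  tfae_have 1 → 2 := by
    intro h
    obtain ⟨C', hC', hq⟩ := hquant ρ K h0 h1
    refine ⟨_, ?_, hq w hw hN h⟩
    have := Bekolle.one_le_bInfty hw
    exact mul_pos hC' (ENNReal.toReal_pos (one_pos.trans_le this).ne' h.ne)
  tfae_have 2 → 1 := fun ⟨C, _, h⟩ => Bekolle.bInfty_lt_top_of_llogL hw h
  tfae_have 2 → 4 := fun ⟨C, hC, h⟩ => Bekolle.smallOnSubsets_of_llogL hw hC h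
  tfae_have 4 → 3 := fun h => h.smallOnIntervalUnions
  tfae_have 3 → 5 := fun h => by
    obtain ⟨ε, δ, _, hε, hδ, hs⟩ := h.smallWith
    exact hs.reverseHolder hw hK.le (hK' w hw hN) hε hδ
  tfae_have 5 → 2 := fun h => h.exists_llogLBound hw
  tfae_have 4 → 6 := fun h => h.exists_bp_lt_top hw h0 h1 hN
  tfae_have 6 → 7 := fun ⟨p, hp, h⟩ => Bekolle.expCondition_of_bp hw hp h
  -- The exponential condition supplies one pair of constants, not every `ε`, so it enters the cycle
  -- at reverse Hölder rather than at smallness.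
  tfae_have 7 → 5 := fun h => by
    obtain ⟨ε, δ, _, hε, hδ, hs⟩ := h.smallWith hw
    exact hs.reverseHolder hw hK.le (hK' w hw hN) hε hδ
  tfae_finish
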